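/- **Definitions.** A *pointed dynamical system* $(G,X)$ is a continuous left action of a discrete group $G$ on a compact metric space $X$ fixing a special point $0\in X$. It is *expansive* if there is $0<\Delta\le 1$ such that $d(g\cdot x,g\cdot y)\le\Delta$ for all $g\in G$ implies $x=y$. A point $x$ is *homoclinic* if for every $\epsilon>0$ we have $d(g\cdot x,0)<\epsilon$ for all but finitely many $g\in G$. An *endomorphism* is a continuous $G$-equivariant $f:X\to X$ with $f(0)=0$. A map $f$ is *nilpotent on* $Y$ if for some $n\in\mathbb N$, $f^n(x)=0$ for all $x\in Y$, and *asymptotically nilpotent on* $Y$ if $f^n(x)\to 0$ for all $x\in Y$; $Y$ is the whole space if not mentioned. A group is *virtually $\mathbb Z$* if it has a finite-index subgroup isomorphic to $\mathbb Z$. A *designation* in $(G,X)$ is a family $(A_i,x_i)_{i\in I}$ where $(A_i)_{i\in I}$ is a partition of $G$ and $x_i\in X$. It is a *$(\delta,E)$-designation* if $d(g\cdot x_i,0)<\delta$ whenever $g\in A_i$ and $Eg\not\subseteq A_i$. For a set $\Gamma$ of self-homeomorphisms of $X$ fixing $0$, an *$(\epsilon,\Gamma)$-realization* of it is a point $y\in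 X$ with $\gamma_i\in\Gamma$ ($i\in I$) such that $d(g\cdot y,\gamma_i(g\cdot x_i))<\epsilon$ for all $i\in I$, $g\in A_i$. A *tiered dynamical system* (TDS) $\mathcal X$ consists of a compact metric space $X$ with a point $0$, a directed set $\mathcal T$ of *tiers* with least element $t_0$, for each $t\in\mathcal T$ an expansive pointed dynamical system $(G_t,X_t)$ with $0\in X_t\subseteq X$ (special point $0$, restricted metric), with $X_t\subseteq X_{t'}$ for $t\le t'$, and for $t\le t'$ finite-to-one surjective homomorphisms $\phi_t^{t'}:G_{t'}\to G_t$ with $\phi^t_t=\mathrm{id}$, $\phi_t^{t'}\circ\phi_{t'}^{t''}=\phi_t^{t''}$, and $\phi_t^{t'}(g)\cdot x=g\cdot x$ for $x\in X_t$, $g\in G_{t'}$. Its *base group* is $G_{t_0}$. An *evolution map* is a continuous $f:X\to X$ such that for $t\le t'$ and $x\in X_t$, $f(x)\in X_{t'}$ implies $f(\phi_t^{t'}(g)\cdot x)=g\cdot f(x)$ for all $g\in G_{t'}$. Let $f$ be an evolution map. The tier $t$ is *$f$-stabilizing with* $s\ge t$ if $f^k(X_t)\subseteq X_s$ for all $k\in\mathbb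 N$, and *$f$-stabilizing* if such $s$ exists. Let $\Lambda_f^t$ be the set of homeomorphisms $\gamma:X_t\to X_t$ with $\gamma(0)=0$, $\gamma(X_r)=X_r$ for all $r\le t$, that commute with $f$, in the sense that $f(\gamma(x))=\gamma(f(x))$ whenever $x,f(x)\in X_t$. The tier $t$ is *weakly $f$-variably $0$-gluing* if there are $w\ge t$ and a finite $\Gamma\subseteq\Lambda_f^w$ such that for all $\epsilon>0$ there are $\delta>0$ and a finite $E\subseteq G_w$ such that every $(\delta,E)$-designation $(A_i,x_i)_{i\in I}$ in $(G_w,X_w)$ with all $x_i\in X_t$ has an $(\epsilon,\Gamma)$-realization in $X_w$. The class $\mathfrak C_1$ consists of the pairs $(\mathcal X,f)$ all of whose tiers are $f$-stabilizing and weakly $f$-variably $0$-gluing. A group $G$ is *nil-rigid on $\mathfrak C_1$* if for every TDS $\mathcal X$ with base group $G$, every asymptotically nilpotent evolution map $f:X\to X$ with $(\mathcal X,f)\in\mathfrak C_1$ is nilpotent on each tier $X_t$. If all groups $G_t$ are $\mathbb Z$ and all $\phi_t^{t'}$ are the identity, the tier $t$ has the *$f$-variable homoclinic recurrence property with* $w\ge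 t$ if there is a finite $\Gamma\subseteq\Lambda_f^w$ such that for each homoclinic $x\in X_t$, all $\epsilon>0$ and $c\in\{1,-1\}$ there is a designation $(A_i,-a_i\cdot x)_{i\in I}$ in $(\mathbb Z,X_w)$ having an $(\epsilon,\Gamma)$-realization in $X_w$, with $a_i\in A_i$ for all $i$ and $\operatorname{sign}(a_i)=c$ for infinitely many $i\in I$. If the base group is virtually $\mathbb Z$, the tier $t$ has this property with $w\ge t$ if for some finite-index subgroup $\mathbb Z\simeq H\le G_w$ it has it in the restricted system in which $H$ acts on every tier $X_r$, $r\le w$, through $\phi_r^w$. **Theorem.** 1. Every virtually $\mathbb Z$ group is nil-rigid on $\mathfrak C_1$. 2. Let $\mathcal X$ be a TDS all of whose groups are $\mathbb Z$ and all of whose homomorphisms $\phi_t^{t'}$ are the identity, and let $f$ be an evolution map. Suppose that the tier $t$ is $f$-stabilizing with $s$, that $s$ has the $f$-variable homoclinic recurrence property with $w$, that $w$ is $f$-stabilizing, and that $f$ is asymptotically nilpotent on $X_w$. Then $f$ is nilpotent on $X_t$. (The case of a single tier concerns an endomorphism of an expansive pointed $\mathbb Z$-system with the $f$-variable homoclinic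 recurrence property.) 3. The same holds for every TDS whose base group is virtually $\mathbb Z$. 4. Let $(\mathbb Z,X)$ be an expansive pointed dynamical system such that for each homoclinic point $x\in X$ and all $\epsilon>0$ there exist $x^1,x^2\in X$ such that for each $i\in\{1,2\}$ and $n\in\mathbb Z$ there is $k\in\mathbb Z$ with $d(n\cdot x^i,k\cdot x)<\epsilon$, and one can choose $k=0$ for infinitely many positive $n$ when $i=1$ and for infinitely many negative $n$ when $i=2$. Then every asymptotically nilpotent endomorphism $f:X\to X$ is nilpotent. -/

import Mathlib

open Filter Topology

universe u v w

namespace NilRigid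

/-! ### Pointed dynamical systems

A continuous left action of a discrete group `G` on a space `Y` is a homomorphism
`ρ : G →* (Y ≃ₜ Y)`; the point `g · y` is `ρ g y`. -/

section Pointed

variable {G : Type*} [Group G] {Y : Type*} [MetricSpace Y]

/-- The action `ρ` is expansive. -/
def IsExpansive (ρ : G →* (Y ≃ₜ Y)) : Prop :=
  ∃ Δ : ℝ, 0 < Δ ∧ Δ ≤ 1 ∧ ∀ x y : Y, (∀ g : G, dist (ρ g x) (ρ g y) ≤ Δ) → x = y

/-- The point `x` is homoclinic, i.e. asymptotic to the special point `o` under the action. -/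
def IsHomoclinic (ρ : G →* (Y ≃ₜ Y)) (o x : Y) : Prop :=
  ∀ ε : ℝ, 0 < ε → ∃ E : Set G, E.Finite ∧ ∀ g : G, g ∉ E → dist (ρ g x) o < ε

/-- `f` is an endomorphism of the pointed dynamical system `(G, Y)` with special point `o`. -/
structure IsEndomorphism (ρ : G →* (Y ≃ₜ Y)) (o : Y) (f : Y → Y) : Prop where
  continuous : Continuous f
  map_zero : f o = o
  map_act : ∀ (g : G) (x : Y), f (ρ g x) = ρ g (f x)

/-- The `E`-border `∂_E A = {g ∈ A | E g ⊄ A}`. -/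
def border (E A : Set G) : Set G := {g | g ∈ A ∧ ∃ e ∈ E, e * g ∉ A}

/-- The sets `A i` partition `G`. Together with a family of points `x i` this is a designation. -/
def IsIndexedPartition {I : Type*} (A : I → Set G) : Prop := ∀ g : G, ∃! i, g ∈ A i

/-- `(A i, x i)` is a `(δ, E)`-designation. -/
def IsDesignation (ρ : G →* (Y ≃ₜ Y)) (o : Y) (δ : ℝ) (E : Set G) {I : Type*}
    (A : I → Set G) (x : I → Y) : Prop :=
  IsIndexedPartition A ∧ ∀ i, ∀ g ∈ border E (A i), dist (ρ g (x i)) o < δ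

/-- `(A i, x i)` has an `(ε, Γ)`-realization `(y, (γ i))`. -/
def HasRealization (ρ : G →* (Y ≃ₜ Y)) (ε : ℝ) (Γ : Set (Y ≃ₜ Y)) {I : Type*}
    (A : I → Set G) (x : I → Y) : Prop :=
  ∃ (y : Y) (γ : I → (Y ≃ₜ Y)), (∀ i, γ i ∈ Γ) ∧
    ∀ i, ∀ g ∈ A i, dist (ρ g y) (γ i (ρ g (x i))) < ε

/-- `f` is nilpotent on the set `S`. -/
def NilpotentOn (f : Y → Y) (o : Y) (S : Set Y) : Prop :=
  ∃ n : ℕ, ∀ x ∈ S, f^[n] x = o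

/-- `f` is asymptotically nilpotent on the set `S`. -/
def AsympNilpotentOn (f : Y → Y) (o : Y) (S : Set Y) : Prop :=
  ∀ x ∈ S, Tendsto (fun n : ℕ => f^[n] x) atTop (𝓝 o)

end Pointed

/-- `G` has a finite-index subgroup isomorphic to `ℤ`. -/
def VirtuallyZ (G : Type*) [Group G] : Prop :=
  ∃ H : Subgroup G, H.FiniteIndex ∧ Nonempty (Multiplicative ℤ ≃* H)

/-! ### Tiered dynamical systems -/

/-- A tiered dynamical system with ambient space `X`, directed set of tiers `T` (with least
element `⊥`) and groups `G t`. -/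
structure TieredSystem (X : Type u) [MetricSpace X] [CompactSpace X]
    (T : Type v) [Preorder T] [IsDirectedOrder T] [OrderBot T]
    (G : T → Type w) [∀ t, Group (G t)] where
  /-- the special point -/
  zero : X
  /-- the sets `X_t` -/
  tier : T → Set X
  isClosed_tier : ∀ t, IsClosed (tier t)
  zero_mem : ∀ t, zero ∈ tier t
  /-- the action of `G_t` on `X_t` -/
  act : ∀ t, G t →* (tier t ≃ₜ tier t)
  act_zero : ∀ t (g : G t), act t g ⟨zero, zero_mem t⟩ = ⟨zero, zero_mem t⟩
  expansive : ∀ t, IsExpansive (act t)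
  tier_mono : ∀ {t t' : T}, t ≤ t' → tier t ⊆ tier t'
  /-- the homomorphisms `G_{t'} → G_t` for `t ≤ t'` -/
  φ : ∀ {t t' : T}, t ≤ t' → (G t' →* G t)
  φ_surjective : ∀ {t t' : T} (h : t ≤ t'), Function.Surjective (φ h)
  φ_finite_to_one : ∀ {t t' : T} (h : t ≤ t') (g : G t), {k : G t' | φ h k = g}.Finite
  φ_refl : ∀ t : T, φ (le_refl t) = MonoidHom.id (G t)
  φ_comp : ∀ {t t' t'' : T} (h : t ≤ t') (h' : t' ≤ t''),
    (φ h).comp (φ h') = φ (h.trans h')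
  act_compat : ∀ {t t' : T} (h : t ≤ t') (x : tier t) (g : G t'),
    (act t (φ h g) x : X) = (act t' g ⟨x, tier_mono h x.2⟩ : X)

namespace TieredSystem

variable {X : Type u} [MetricSpace X] [CompactSpace X]
  {T : Type v} [Preorder T] [IsDirectedOrder T] [OrderBot T]
  {G : T → Type w} [∀ t, Group (G t)]

/-- The special point as an element of the tier `X_t`. -/
def zeroAt (𝒳 : TieredSystem X T G) (t : T) : 𝒳.tier t := ⟨𝒳.zero, 𝒳.zero_mem t⟩

/-- The inclusion `X_t ⊆ X_{t'}`. -/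
def incl (𝒳 : TieredSystem X T G) {t t' : T} (h : t ≤ t') (x : 𝒳.tier t) : 𝒳.tier t' :=
  ⟨x, 𝒳.tier_mono h x.2⟩

/-- `f` is an evolution map. -/
structure IsEvolution (𝒳 : TieredSystem X T G) (f : X → X) : Prop where
  continuous : Continuous f
  map_act : ∀ {t t' : T} (h : t ≤ t') (x : 𝒳.tier t) (hx : f x ∈ 𝒳.tier t') (g : G t'),
    f (𝒳.act t (𝒳.φ h g) x) = 𝒳.act t' g ⟨f x, hx⟩

/-- The tier `t` is `f`-stabilizing, with `s` as the choice of `s(t)`. -/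
def StabilizesAt (𝒳 : TieredSystem X T G) (f : X → X) (t s : T) : Prop :=
  t ≤ s ∧ ∀ k : ℕ, ∀ x ∈ 𝒳.tier t, f^[k] x ∈ 𝒳.tier s

/-- The tier `t` is `f`-stabilizing. -/
def IsStabilizing (𝒳 : TieredSystem X T G) (f : X → X) (t : T) : Prop :=
  ∃ s, 𝒳.StabilizesAt f t s

/-- The set `Λ_f^t` of homeomorphisms of `X_t` that commute with `f`, preserve all tiers
`r ≤ t`, and fix the special point. As `f` need not map `X_t` to itself, commutation
`f (γ x) = γ (f x)` is required where the right-hand side is defined. -/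
def symmetries (𝒳 : TieredSystem X T G) (f : X → X) (t : T) : Set (𝒳.tier t ≃ₜ 𝒳.tier t) :=
  {γ | (∀ (x : 𝒳.tier t) (hx : f x ∈ 𝒳.tier t), f (γ x) = γ ⟨f x, hx⟩) ∧
    (∀ r : T, r ≤ t → γ '' {x | (x : X) ∈ 𝒳.tier r} = {x | (x : X) ∈ 𝒳.tier r}) ∧
    γ (𝒳.zeroAt t) = 𝒳.zeroAt t}

/-- The tier `t` is weakly `f`-variably `0`-gluing. -/
def IsWeaklyVariablyGluing (𝒳 : TieredSystem X T G) (f : X → X) (t : T) : Prop :=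
  ∃ (w' : T) (h : t ≤ w') (Γ : Set (𝒳.tier w' ≃ₜ 𝒳.tier w')),
    Γ.Finite ∧ Γ ⊆ 𝒳.symmetries f w' ∧
    ∀ ε : ℝ, 0 < ε → ∃ (δ : ℝ) (E : Set (G w')), 0 < δ ∧ E.Finite ∧
      ∀ (I : Type w) (A : I → Set (G w')) (x : I → 𝒳.tier t),
        IsDesignation (𝒳.act w') (𝒳.zeroAt w') δ E A (fun i => 𝒳.incl h (x i)) →
        HasRealization (𝒳.act w') ε Γ A (fun i => 𝒳.incl h (x i))

/-- The `f`-variable homoclinic recurrence property of the tier `t` with `w'` as the choice of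
`w(t)`, for the system in which `ℤ` acts on the tiers `r ≤ w'` through `ψ : ℤ → G_{w'}`
(and the homomorphisms `G_{w'} → G_r`). -/
def HomoclinicRecurrenceVia (𝒳 : TieredSystem X T G) (f : X → X) {t w' : T} (h : t ≤ w')
    (ψ : Multiplicative ℤ →* G w') : Prop :=
  ∃ Γ : Set (𝒳.tier w' ≃ₜ 𝒳.tier w'), Γ.Finite ∧ Γ ⊆ 𝒳.symmetries f w' ∧
    ∀ x : 𝒳.tier t,
      IsHomoclinic ((𝒳.act t).comp ((𝒳.φ h).comp ψ)) (𝒳.zeroAt t) x →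
      ∀ ε : ℝ, 0 < ε → ∀ c : ℤ, c = 1 ∨ c = -1 →
        ∃ (I : Type) (A : I → Set (Multiplicative ℤ)) (a : I → ℤ),
          IsIndexedPartition A ∧
          (∀ i, Multiplicative.ofAdd (a i) ∈ A i) ∧
          {i | (a i).sign = c}.Infinite ∧
          HasRealization ((𝒳.act w').comp ψ) ε Γ A
            (fun i => 𝒳.incl h
              (𝒳.act t (𝒳.φ h (ψ (Multiplicative.ofAdd (-(a i))))) x))

/-- The `f`-variable homoclinic recurrence property of the tier `t` with `w'` as the choice of
`w(t)`: it holds for the action of some finite-index subgroup of `G_{w'}` isomorphic to `ℤ`. -/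
def HomoclinicRecurrence (𝒳 : TieredSystem X T G) (f : X → X) {t w' : T} (h : t ≤ w') : Prop :=
  ∃ H : Subgroup (G w'), H.FiniteIndex ∧
    ∃ e : Multiplicative ℤ ≃* H, 𝒳.HomoclinicRecurrenceVia f h (H.subtype.comp e.toMonoidHom)

end TieredSystem

/-- An evolution of a tiered dynamical system: a tiered system bundled with an evolution map. -/
structure ETDS where
  X : Type u
  [metricSpace : MetricSpace X]
  [compactSpace : CompactSpace X]
  T : Type v
  [preorder : Preorder T]
  [isDirected : IsDirectedOrder T]
  [orderBot : OrderBot T]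
  G : T → Type w
  [group : ∀ t, Group (G t)]
  sys : TieredSystem X T G
  f : X → X
  isEvolution : sys.IsEvolution f

attribute [instance] ETDS.metricSpace ETDS.compactSpace ETDS.preorder ETDS.isDirected
  ETDS.orderBot ETDS.group

/-- The class `𝔠₁` of the `f`-stabilizing, weakly `f`-variably `0`-gluing systems. -/
def classC1 : Set ETDS.{u, v, w} :=
  {𝒵 | (∀ t, 𝒵.sys.IsStabilizing 𝒵.f t) ∧ ∀ t, 𝒵.sys.IsWeaklyVariablyGluing 𝒵.f t}

/-- The tiered system `𝒳` is nil-rigid on the class `𝒞`. -/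
def TieredSystem.NilRigidOn {X : Type u} [MetricSpace X] [CompactSpace X]
    {T : Type v} [Preorder T] [IsDirectedOrder T] [OrderBot T]
    {G : T → Type w} [∀ t, Group (G t)]
    (𝒞 : Set ETDS.{u, v, w}) (𝒳 : TieredSystem X T G) : Prop :=
  ∀ (f : X → X) (hf : 𝒳.IsEvolution f),
    (⟨X, T, G, 𝒳, f, hf⟩ : ETDS.{u, v, w}) ∈ 𝒞 →
    AsympNilpotentOn f 𝒳.zero Set.univ →
    ∀ t, NilpotentOn f 𝒳.zero (𝒳.tier t)

/-- The group `G₀` is nil-rigid on the class `𝒞`: every tiered system whose base group is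
(isomorphic to) `G₀` is. -/
def GroupNilRigidOn (𝒞 : Set ETDS.{u, v, w}) (G₀ : Type w) [Group G₀] : Prop :=
  ∀ (X : Type u) [MetricSpace X] [CompactSpace X]
    (T : Type v) [Preorder T] [IsDirectedOrder T] [OrderBot T]
    (G : T → Type w) [∀ t, Group (G t)] (𝒳 : TieredSystem X T G),
    Nonempty (G ⊥ ≃* G₀) → 𝒳.NilRigidOn 𝒞

end NilRigid

open NilRigid

open NilRigid

namespace NilRigid

/-! ### Almost minimal `ℤ²`-actions -/

section AlmostMinimal

variable {M : Type*} [TopologicalSpace M] [CompactSpace M] {τ : ℤ → ℤ → M → M} {ν : M → ℝ}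

/-! Suppose `f` is asymptotically nilpotent but not nilpotent. The proof first finds a spaceship: a
nonzero homoclinic `z` with `f^[p] z = σ q z`. It then shows that recurrence of homoclinic points
excludes spaceships.

Existence (`IsZEndomorphism.exists_spaceship`). Non-nilpotency and compactness give two-sided
trajectories of `f` that are far from `o` at time 0. Together with the shift in time, `σ` acts on
trajectories as `ℤ²`, and Zorn's lemma gives a minimal closed invariant set containing such a
trajectory. Minimality makes the orbit of every point that is nonzero at time 0 meet every nonempty
open set. Two Baire arguments follow: every column of the space-time diagram is active only finitely
often (`finite_column`), and every active cell lies near a strip that is quiet except around the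
time of that cell (`exists_wall`). Since activity must have a nearby cause one step earlier, it can
be followed backwards in time. The path leaves every column, so it drifts left or right, and the
strips prevent other activity from remaining at intermediate distances. Limits of the diagram along
the path have bounded support. Expansiveness leaves only finitely many such points, and `f` carries
each to a translate of another, so a pigeonhole produces the spaceship.

Exclusion (`not_recurrent`, `not_repeated`). Asymptotic nilpotency forces `q ≠ 0`. Recurrence gives
a point `y` whose orbit follows copies of `z` and returns near `z`, up to symmetries, infinitely
often in the direction of `q`. For a good enough approximation, expansiveness makes `y` satisfy
`f^[P] y = σ Q y` exactly, with `Q` of the sign of `q`. Hence `σ n y` tends to `o` in that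
direction, a contradiction.

For tiered systems, `ℤ` is lifted to a syndetic copy in a higher group, and gluing yields recurrence
by placing a homoclinic point at sparse positions. -/

theorem exists_visit_bound (hτ : ∀ j n, Continuous (τ j n)) (hν : Continuous ν)
    (hmin : ∀ U : Set M, IsOpen U → U.Nonempty → ∀ x, 0 < ν x → ∃ j n, τ j n x ∈ U)
    {U : Set M} (hU : IsOpen U) (hne : U.Nonempty) {η : ℝ} (hη : 0 < η) :
    ∃ K : ℕ, ∀ x, η ≤ ν x → ∃ j n : ℤ, |j| ≤ K ∧ |n| ≤ K ∧ τ j n x ∈ U := by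
  have hcl : IsCompact {x | η ≤ ν x} := (isClosed_le continuous_const hν).isCompact
  let V : ℕ → Set M := fun K => {x | ∃ j n : ℤ, |j| ≤ K ∧ |n| ≤ K ∧ τ j n x ∈ U}
  have hV : ∀ K, IsOpen (V K) := by
    intro K
    have : V K = ⋃ j : ℤ, ⋃ n : ℤ, ⋃ _ : |j| ≤ K ∧ |n| ≤ K, τ j n ⁻¹' U := by
      ext x
      simp [V]
    rw [this]
    exact isOpen_iUnion fun j => isOpen_iUnion fun n => isOpen_iUnion fun _ =>
      hU.preimage (hτ j n)
  obtain ⟨K, hK⟩ := hcl.elim_directed_cover V hV (by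
    intro x hx
    obtain ⟨j, n, h⟩ := hmin U hU hne x (hη.trans_le hx)
    refine Set.mem_iUnion.2 ⟨max j.natAbs n.natAbs, j, n, ?_, ?_, h⟩ <;> push_cast <;> simp)
    (directed_of_isDirected_le (by
      rintro a b hab x ⟨j, n, hj, hn, h⟩
      have : (a : ℤ) ≤ b := by exact_mod_cast hab
      exact ⟨j, n, hj.trans this, hn.trans this, h⟩))
  exact ⟨K, fun x hx => hK hx⟩

/-- By Baire, some nonempty open `U` inside `{κ < ν}` consists of points whose forward column stays
at or below `κ` after a common time `N`. Two visits of one column to `U` are thus less than `N`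
apart, which bounds visits in both time directions although only forward convergence is assumed.
Every active time is within bounded distance of such a visit. -/
theorem finite_column [BaireSpace M] (hτ : ∀ j n, Continuous (τ j n)) (hν : Continuous ν)
    (hadd : ∀ j n j' n' x, τ j n (τ j' n' x) = τ (j + j') (n + n') x)
    (hmin : ∀ U : Set M, IsOpen U → U.Nonempty → ∀ x, 0 < ν x → ∃ j n, τ j n x ∈ U)
    (hlim : ∀ x, Tendsto (fun n : ℕ => ν (τ 0 n x)) atTop (𝓝 0))
    (hpos : ∃ x, 0 < ν x) (x : M) {η : ℝ} (hη : 0 < η) :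
    {n : ℤ | η ≤ ν (τ 0 n x)}.Finite := by
  obtain ⟨x₀, hx₀⟩ := hpos
  set κ := ν x₀ / 2 with hκ
  have hκ0 : 0 < κ := by positivity
  let F : ℕ → Set M := fun N => {x | ∀ n : ℕ, N ≤ n → ν (τ 0 n x) ≤ κ}
  have hF : ∀ N, IsClosed (F N) := by
    intro N
    have : F N = ⋂ n : ℕ, ⋂ _ : N ≤ n, {x | ν (τ 0 n x) ≤ κ} := by ext; simp [F]
    rw [this]
    exact isClosed_iInter fun n => isClosed_iInter fun _ =>
      isClosed_le (hν.comp (hτ 0 n)) continuous_const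
  have hFU : ⋃ N, F N = Set.univ := by
    refine Set.eq_univ_of_forall fun x => ?_
    obtain ⟨N, hN⟩ := eventually_atTop.1 ((hlim x).eventually (gt_mem_nhds hκ0))
    exact Set.mem_iUnion.2 ⟨N, fun n hn => (hN n hn).le⟩
  have hdense := dense_iUnion_interior_of_closed hF hFU
  obtain ⟨x₁, hx₁, hx₁'⟩ := hdense.inter_open_nonempty {x | κ < ν x}
    (isOpen_lt continuous_const hν) ⟨x₀, by show κ < ν x₀; rw [hκ]; linarith⟩
  obtain ⟨N, hN⟩ := Set.mem_iUnion.1 hx₁'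
  let U : Set M := interior (F N) ∩ {x | κ < ν x}
  have hUo : IsOpen U := isOpen_interior.inter (isOpen_lt continuous_const hν)
  have hUN : ∀ y, ∀ j m n : ℤ, τ j m y ∈ U → τ j n y ∈ U → n < m + N := by
    intro y j m n hm hn
    by_contra! hlt
    obtain ⟨k, hk⟩ := Int.eq_ofNat_of_zero_le (show 0 ≤ n - m by omega)
    have h1 := interior_subset hm.1 k (by omega)
    rw [hadd, zero_add, show (k : ℤ) + m = n by omega] at h1
    exact absurd hn.2 (not_lt.2 h1)
  obtain ⟨K, hK⟩ := exists_visit_bound hτ hν hmin hUo ⟨x₁, hN, hx₁⟩ hη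
  have hvis : ∀ j : ℤ, {n : ℤ | τ j n x ∈ U}.Finite := by
    intro j
    rcases Set.eq_empty_or_nonempty {n : ℤ | τ j n x ∈ U} with h | ⟨m, hm⟩
    · rw [h]; exact Set.finite_empty
    · refine (Set.finite_Icc (m - N) (m + N)).subset fun n hn => ?_
      have h1 := hUN x j m n hm hn
      have h2 := hUN x j n m hn hm
      exact ⟨by omega, by omega⟩
  have hfin : (⋃ j ∈ Set.Icc (-K : ℤ) K, ⋃ k ∈ Set.Icc (-K : ℤ) K,
      (fun n => n - k) '' {n : ℤ | τ j n x ∈ U}).Finite :=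
    (Set.finite_Icc _ _).biUnion fun j _ => (Set.finite_Icc _ _).biUnion fun k _ =>
      (hvis j).image _
  refine hfin.subset fun n hn => ?_
  obtain ⟨j, k, hj, hk, h⟩ := hK _ hn
  rw [hadd] at h
  simp only [Set.mem_iUnion]
  exact ⟨j, abs_le.1 hj, k, abs_le.1 hk, k + n, by simpa using h, by ring⟩

/-- A second use of Baire: since columns are finite, every point has its central strip quiet outside
some time window, so one window works on an open set. Bounded visits to that set put a wall near
every active cell. -/
theorem exists_wall [BaireSpace M] [Nonempty M] (hτ : ∀ j n, Continuous (τ j n))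
    (hν : Continuous ν)
    (hadd : ∀ j n j' n' x, τ j n (τ j' n' x) = τ (j + j') (n + n') x)
    (hmin : ∀ U : Set M, IsOpen U → U.Nonempty → ∀ x, 0 < ν x → ∃ j n, τ j n x ∈ U)
    (hcol : ∀ x, ∀ η : ℝ, 0 < η → {n : ℤ | η ≤ ν (τ 0 n x)}.Finite)
    (r : ℕ) {ε : ℝ} (hε : 0 < ε) :
    ∃ K D : ℕ, ∀ x, ε ≤ ν x → ∃ i : ℤ, |i| ≤ K ∧
      ∀ j n : ℤ, |j - i| ≤ r → (D : ℤ) < |n| → ν (τ j n x) < ε := by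
  let F : ℕ → Set M := fun D => {x | ∀ j n : ℤ, |j| ≤ r → (D : ℤ) < |n| → ν (τ j n x) ≤ ε / 2}
  have hF : ∀ D, IsClosed (F D) := by
    intro D
    have : F D = ⋂ j : ℤ, ⋂ n : ℤ, ⋂ _ : |j| ≤ r, ⋂ _ : (D : ℤ) < |n|,
        {x | ν (τ j n x) ≤ ε / 2} := by ext; simp [F]
    rw [this]
    exact isClosed_iInter fun j => isClosed_iInter fun n => isClosed_iInter fun _ =>
      isClosed_iInter fun _ => isClosed_le (hν.comp (hτ j n)) continuous_const
  have hFU : ⋃ D, F D = Set.univ := by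
    refine Set.eq_univ_of_forall fun x => ?_
    have hfin : (⋃ j ∈ Set.Icc (-r : ℤ) r, {n : ℤ | ε / 2 ≤ ν (τ j n x)}).Finite := by
      refine (Set.finite_Icc _ _).biUnion fun j _ => ?_
      have := hcol (τ j 0 x) (ε / 2) (by positivity)
      simpa [hadd] using this
    obtain ⟨D, hD⟩ := (hfin.image Int.natAbs).bddAbove
    refine Set.mem_iUnion.2 ⟨D, fun j n hj hn => ?_⟩
    by_contra! hlt
    have := hD (Set.mem_image_of_mem _ (Set.mem_biUnion (abs_le.1 hj) hlt.le))
    rw [Int.abs_eq_natAbs] at hn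
    omega
  obtain ⟨D, hD⟩ := nonempty_interior_of_iUnion_of_closed hF hFU
  obtain ⟨K, hK⟩ := exists_visit_bound hτ hν hmin isOpen_interior hD hε
  -- The visit may occur up to `K` time steps away, which shifts the quiet window.
  refine ⟨K, D + K, fun x hx => ?_⟩
  obtain ⟨i, k, hi, hk, h⟩ := hK x hx
  refine ⟨i, hi, fun j n hj hn => ?_⟩
  have h1 := interior_subset h (j - i) (n - k) hj (by
    have := abs_sub_abs_le_abs_sub n k
    push_cast at hn
    omega)
  rw [hadd, sub_add_cancel, sub_add_cancel] at h1
  linarith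

end AlmostMinimal

/-! ### Backward paths in space-time diagrams -/

section Paths

theorem exists_crossing_up {a : ℕ → ℤ} {r i : ℤ} (hstep : ∀ n, |a (n + 1) - a n| ≤ r)
    (h0 : a 0 < i) (hm : ∃ m, i ≤ a m) : ∃ m, |a m - i| ≤ r := by
  classical
  have h1 := Nat.find_spec hm
  have hpos : Nat.find hm ≠ 0 := fun h => by rw [h] at h1; omega
  obtain ⟨k, hk⟩ := Nat.exists_eq_succ_of_ne_zero hpos
  have h2 := Nat.find_min hm (show k < Nat.find hm by omega)
  rw [hk] at h1
  have h3 := abs_le.1 (hstep k)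
  exact ⟨k + 1, abs_le.2 ⟨by simp only [Nat.succ_eq_add_one] at h1; omega, by omega⟩⟩

theorem exists_crossing_down {a : ℕ → ℤ} {r i : ℤ} (hstep : ∀ n, |a (n + 1) - a n| ≤ r)
    (h0 : i < a 0) (hm : ∃ m, a m ≤ i) : ∃ m, |a m - i| ≤ r := by
  obtain ⟨m, h⟩ := exists_crossing_up (a := fun n => -a n) (r := r) (i := -i)
    (fun n => by rw [← abs_neg]; convert hstep n using 2; ring) (by omega)
    (by obtain ⟨m, h⟩ := hm; exact ⟨m, by omega⟩)
  exact ⟨m, by rw [← abs_neg]; convert h using 2; ring⟩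

theorem abs_sub_le_of_step {a : ℕ → ℤ} {r : ℕ} (hstep : ∀ n, |a (n + 1) - a n| ≤ r) (m : ℕ) :
    |a m - a 0| ≤ r * m := by
  induction m with
  | zero => simp
  | succ m ih =>
    have := abs_sub_le (a (m + 1)) (a m) (a 0)
    have := hstep m
    push_cast
    rw [mul_add, mul_one]
    omega

/-- Finite fibres force `|a n| > r` eventually, and from then on a step of size at most `r` cannot
change the sign. -/
theorem tendsto_atBot_or_atTop {a : ℕ → ℤ} {r : ℕ} (hstep : ∀ n, |a (n + 1) - a n| ≤ r)
    (hfin : ∀ j, {n | a n = j}.Finite) : Tendsto a atTop atBot ∨ Tendsto a atTop atTop := by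
  have hcof : ∀ B : ℕ, ∀ᶠ n in atTop, (B : ℤ) < |a n| := by
    intro B
    have : (⋃ j ∈ Set.Icc (-B : ℤ) B, {n | a n = j}).Finite :=
      (Set.finite_Icc _ _).biUnion fun j _ => hfin j
    have h2 := this.compl_mem_cofinite
    rw [Nat.cofinite_eq_atTop] at h2
    filter_upwards [h2] with n hn
    by_contra! h
    exact hn (Set.mem_biUnion (abs_le.1 h) rfl)
  obtain ⟨n₀, hn₀⟩ := eventually_atTop.1 (hcof r)
  rcases lt_or_ge (a n₀) 0 with hneg | hpos
  · left
    have hs : ∀ n, n₀ ≤ n → a n < 0 := by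
      intro n hn
      induction n, hn using Nat.le_induction with
      | base => exact hneg
      | succ n hn ih =>
        have h1 := hn₀ (n + 1) (by omega)
        have h2 := hn₀ n hn
        have h3 := abs_le.1 (hstep n)
        rw [abs_of_neg ih] at h2
        omega
    refine tendsto_atBot.2 fun b => ?_
    filter_upwards [hcof b.natAbs, eventually_ge_atTop n₀] with n h1 h2
    rw [abs_of_neg (hs n h2)] at h1
    omega
  · right
    have hs : ∀ n, n₀ ≤ n → 0 ≤ a n := by
      intro n hn
      induction n, hn using Nat.le_induction with
      | base => exact hpos
      | succ n hn ih =>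
        have h1 := hn₀ (n + 1) (by omega)
        have h2 := hn₀ n hn
        have h3 := abs_le.1 (hstep n)
        rw [abs_of_nonneg ih] at h2
        omega
    refine tendsto_atTop.2 fun b => ?_
    filter_upwards [hcof b.natAbs, eventually_ge_atTop n₀] with n h1 h2
    rw [abs_of_nonneg (hs n h2)] at h1
    omega

variable {N : ℤ → ℤ → Prop} {r K D : ℕ}

/-- Read `N j n` as activity at position `j` and time `n`; the hypothesis says that activity has a
cause within distance `r` one step earlier. -/
theorem exists_backward_path
    (hP : ∀ j n, N j n → ∃ j', |j' - j| ≤ r ∧ N j' (n - 1)) {j n : ℤ} (h : N j n) :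
    ∃ a : ℕ → ℤ, a 0 = j ∧ (∀ m, |a (m + 1) - a m| ≤ r) ∧ ∀ m : ℕ, N (a m) (n - m) := by
  choose! s hs using hP
  let b : ℕ → ℤ := fun m => Nat.rec j (fun k x => s x (n - k)) m
  have hb : ∀ m : ℕ, N (b m) (n - m) := by
    intro m
    induction m with
    | zero => simpa [b] using h
    | succ k ih =>
      have := (hs _ _ ih).2
      have e : n - ((k + 1 : ℕ) : ℤ) = n - k - 1 := by push_cast; ring
      rw [e]; exact this
  exact ⟨b, rfl, fun m => (hs _ _ (hb m)).1, hb⟩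

/-- A path running to the left carries everything to its left along. -/
theorem sub_le_of_tendsto_atBot
    (hW : ∀ j n, N j n → ∃ i : ℤ, |i - j| ≤ K ∧
      ∀ j' n' : ℤ, |j' - i| ≤ r → (D : ℤ) < |n' - n| → ¬ N j' n')
    {a : ℕ → ℤ} {n : ℤ} (hstep : ∀ m, |a (m + 1) - a m| ≤ r) (ha : ∀ m : ℕ, N (a m) (n - m))
    (hlim : Tendsto a atTop atBot) {j : ℤ} (hj : N j n) : a 0 - (K + r + r * D) ≤ j := by
  by_contra! hlt
  obtain ⟨i, hi, hz⟩ := hW j n hj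
  rw [abs_le] at hi
  have hrD : (0 : ℤ) ≤ r * D := by positivity
  -- The path must cross the wall near `j`. After more than `D` steps the wall is quiet; within `D`
  -- steps the path moves at most `r * D`, too little to reach it.
  obtain ⟨m, hm⟩ := exists_crossing_down hstep (i := i) (by omega)
    (hlim.eventually_le_atBot i).exists
  refine hz (a m) (n - m) hm ?_ (ha m)
  by_contra! hle
  have h1 : (m : ℤ) ≤ D := by
    rw [sub_sub_cancel_left, abs_neg, abs_of_nonneg (by positivity)] at hle
    exact hle
  have h2 := abs_le.1 (abs_sub_le_of_step hstep m)
  have h3 : (r : ℤ) * m ≤ r * D := by gcongr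
  rw [abs_le] at hm
  omega

/-- Activity cannot lie far to the left of a left-going path. Activity to its right has its own
backward path: if that goes left, the same estimate bounds the gap, and if it goes right, it must
cross a wall fixed near `a 0` at a time when that wall is quiet. -/
theorem exists_thin_path_of_tendsto_atBot
    (hP : ∀ j n, N j n → ∃ j', |j' - j| ≤ r ∧ N j' (n - 1))
    (hW : ∀ j n, N j n → ∃ i : ℤ, |i - j| ≤ K ∧
      ∀ j' n' : ℤ, |j' - i| ≤ r → (D : ℤ) < |n' - n| → ¬ N j' n')
    (hF : ∀ j, {n | N j n}.Finite) {a : ℕ → ℤ} (hstep : ∀ m, |a (m + 1) - a m| ≤ r)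
    (ha : ∀ m : ℕ, N (a m) (-m)) (hlim : Tendsto a atTop atBot) (B : ℕ) :
    ∀ᶠ m : ℕ in atTop, ∀ j : ℤ, ((K + r + r * D : ℕ) : ℤ) < |j - a m| → |j - a m| ≤ B →
      ¬ N j (-m) := by
  obtain ⟨i, hi, hz⟩ := hW (a 0) 0 (by simpa using ha 0)
  filter_upwards [hlim.eventually_le_atBot (i - B - 1), eventually_gt_atTop D]
    with m hm hmD j hj hjB hN
  push_cast at hj
  have h1 := sub_le_of_tendsto_atBot hW (a := fun k => a (m + k)) (n := -m)
    (fun k => hstep (m + k))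
    (fun k => by have := ha (m + k); push_cast at this; rwa [neg_add, ← sub_eq_add_neg] at this)
    (hlim.comp (tendsto_add_atTop_nat m |>.congr fun k => add_comm k m)) hN
  simp only [add_zero] at h1
  obtain ⟨b, hb0, hbs, hb⟩ := exists_backward_path hP hN
  have hbfin : ∀ l, {k | b k = l}.Finite := by
    intro l
    refine Set.Finite.of_finite_image (f := fun k : ℕ => -(m : ℤ) - k)
      ((hF l).subset ?_) (fun k _ k' _ h => by simpa using h)
    rintro _ ⟨k, hk, rfl⟩
    have := hb k
    rwa [show b k = l from hk] at this
  rcases tendsto_atBot_or_atTop hbs hbfin with hbot | htop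
  · have h2 := sub_le_of_tendsto_atBot hW hbs hb hbot (ha m)
    rw [lt_abs] at hj
    omega
  · rw [abs_le] at hjB
    obtain ⟨k, hk⟩ := exists_crossing_up hbs (i := i) (by omega)
      (htop.eventually_ge_atTop i).exists
    refine hz _ _ hk ?_ (hb k)
    rw [sub_zero, lt_abs]
    right
    omega

theorem exists_thin_path
    (hP : ∀ j n, N j n → ∃ j', |j' - j| ≤ r ∧ N j' (n - 1))
    (hW : ∀ j n, N j n → ∃ i : ℤ, |i - j| ≤ K ∧
      ∀ j' n' : ℤ, |j' - i| ≤ r → (D : ℤ) < |n' - n| → ¬ N j' n')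
    (hF : ∀ j, {n | N j n}.Finite) (h0 : N 0 0) :
    ∃ a : ℕ → ℤ, (∀ m, |a (m + 1) - a m| ≤ r) ∧ (∀ m : ℕ, N (a m) (-m)) ∧
      ∀ B : ℕ, ∀ᶠ m : ℕ in atTop, ∀ j : ℤ, ((K + r + r * D : ℕ) : ℤ) < |j - a m| →
        |j - a m| ≤ B → ¬ N j (-m) := by
  obtain ⟨a, -, hs, ha⟩ := exists_backward_path hP h0
  simp only [zero_sub] at ha
  have hfin : ∀ l, {k | a k = l}.Finite := by
    intro l
    refine Set.Finite.of_finite_image (f := fun k : ℕ => -(k : ℤ))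
      ((hF l).subset ?_) (fun k _ k' _ h => by simpa using h)
    rintro _ ⟨k, hk, rfl⟩
    have := ha k
    rwa [show a k = l from hk] at this
  refine ⟨a, hs, ha, fun B => ?_⟩
  rcases tendsto_atBot_or_atTop hs hfin with hbot | htop
  · exact exists_thin_path_of_tendsto_atBot hP hW hF hs ha hbot B
  -- A right-going path becomes left-going after the reflection `j ↦ -j`.
  · have key := exists_thin_path_of_tendsto_atBot (N := fun j n => N (-j) n) (r := r) (K := K)
      (D := D) (a := fun m => -a m)
      (fun j n h => by
        obtain ⟨j', h1, h2⟩ := hP _ _ h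
        refine ⟨-j', ?_, by simpa using h2⟩
        rw [← abs_neg]; convert h1 using 2; ring)
      (fun j n h => by
        obtain ⟨i, h1, h2⟩ := hW _ _ h
        refine ⟨-i, by rw [← abs_neg]; convert h1 using 2; ring, fun j' n' h3 h4 => ?_⟩
        refine h2 _ _ ?_ h4
        rw [← abs_neg]; convert h3 using 2; ring)
      (fun j => hF (-j))
      (fun m => by rw [← abs_neg]; convert hs m using 2; ring)
      (fun m => by simpa using ha m) (tendsto_neg_atTop_atBot.comp htop) B
    filter_upwards [key] with m hm j hj hjB
    have e : |(-j) - (-a m)| = |j - a m| := by rw [← abs_neg]; congr 1; ring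
    have := hm (-j) (by rw [e]; exact hj) (by rw [e]; exact hjB)
    simpa using this

end Paths

/-! ### Spaceships in expansive pointed `ℤ`-systems -/

/-- `f` is an endomorphism of the pointed `ℤ`-system on `Y` given by the maps `σ n`, which is
expansive with constant `Δ`. -/
structure IsZEndomorphism {Y : Type*} [MetricSpace Y] (σ : ℤ → Y → Y) (o : Y) (f : Y → Y)
    (Δ : ℝ) : Prop where
  continuous_shift : ∀ n, Continuous (σ n)
  shift_zero : ∀ x, σ 0 x = x
  shift_add : ∀ m n x, σ (m + n) x = σ m (σ n x)
  shift_base : ∀ n, σ n o = o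
  continuous : Continuous f
  map_base : f o = o
  comm : ∀ n x, f (σ n x) = σ n (f x)
  pos : 0 < Δ
  expansive : ∀ x y, (∀ n, dist (σ n x) (σ n y) ≤ Δ) → x = y

theorem exists_modulus {ι Y Z : Type*} [MetricSpace Y] [CompactSpace Y] [MetricSpace Z]
    {g : ι → Y → Z} (hg : ∀ i, Continuous (g i)) {s : Set ι} (hs : s.Finite) {η : ℝ}
    (hη : 0 < η) : ∃ κ > 0, ∀ i ∈ s, ∀ u v, dist u v < κ → dist (g i u) (g i v) < η := by
  have h : ∀ i, ∃ κ > 0, ∀ u v, dist u v < κ → dist (g i u) (g i v) < η := fun i => by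
    obtain ⟨κ, hκ, h⟩ := Metric.uniformContinuous_iff.1
      (CompactSpace.uniformContinuous_of_continuous (hg i)) η hη
    exact ⟨κ, hκ, fun u v huv => h huv⟩
  choose κ hκ h using h
  induction s, hs using Set.Finite.induction_on with
  | empty => exact ⟨1, one_pos, by simp⟩
  | @insert a s _ _ ih =>
    obtain ⟨κ', hκ', ih⟩ := ih
    refine ⟨min (κ a) κ', lt_min (hκ a) hκ', ?_⟩
    rintro i (rfl | hi) u v huv
    · exact h i u v (huv.trans_le (min_le_left _ _))
    · exact ih i hi u v (huv.trans_le (min_le_right _ _))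

namespace IsZEndomorphism

variable {Y : Type*} [MetricSpace Y] {σ : ℤ → Y → Y} {o : Y} {f : Y → Y} {Δ : ℝ}

theorem exists_far (h : IsZEndomorphism σ o f Δ) {x : Y} (hx : x ≠ o) :
    ∃ n, Δ < dist (σ n x) o := by
  by_contra! hle
  exact hx (h.expansive x o fun n => by rw [h.shift_base]; exact hle n)

theorem iterate_comm (h : IsZEndomorphism σ o f Δ) (k : ℕ) (n : ℤ) (x : Y) :
    f^[k] (σ n x) = σ n (f^[k] x) :=
  (Function.Commute.iterate_left (f := f) (g := σ n) (fun x => h.comm n x) k) x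

/-- `z` is a nonzero homoclinic point that `f` moves along its orbit. -/
def IsSpaceship (σ : ℤ → Y → Y) (o : Y) (f : Y → Y) (p : ℕ) (q : ℤ) (z : Y) : Prop :=
  z ≠ o ∧ 0 < p ∧ f^[p] z = σ q z ∧ Tendsto (fun n => σ n z) cofinite (𝓝 o)

/-- The two-sided trajectories of `f`. -/
def trajectories (f : Y → Y) : Set (ℤ → Y) := {x | ∀ n, f (x n) = x (n + 1)}

/-- The action of `ℤ²` on sequences, by `σ` and by the shift. -/
def translate (σ : ℤ → Y → Y) (j n : ℤ) (x : ℤ → Y) : ℤ → Y := fun k => σ j (x (k + n))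

variable [CompactSpace Y]

/-- Two such points are within `2 * ε ≤ Δ` of each other outside the window. If they are also close
enough to agree to `Δ` inside it, they coincide; so each ball of a finite cover contains at most
one. -/
theorem finite_support (h : IsZEndomorphism σ o f Δ) {ε : ℝ} (hε : 2 * ε ≤ Δ) (Q : ℕ) :
    {z : Y | ∀ l : ℤ, (Q : ℤ) < |l| → dist (σ l z) o ≤ ε}.Finite := by
  obtain ⟨κ, hκ, hmod⟩ := exists_modulus h.continuous_shift (Set.finite_Icc (-Q : ℤ) Q) h.pos
  obtain ⟨t, -, ht, hcov⟩ := finite_cover_balls_of_compact (isCompact_univ (X := Y))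
    (half_pos hκ)
  refine (ht.biUnion (t := fun c =>
    {z : Y | ∀ l : ℤ, (Q : ℤ) < |l| → dist (σ l z) o ≤ ε} ∩ Metric.ball c (κ / 2)) ?_).subset ?_
  · rintro c -
    refine Set.Subsingleton.finite ?_
    rintro y ⟨hy, hyc⟩ z ⟨hz, hzc⟩
    refine h.expansive y z fun l => ?_
    rcases le_or_gt |l| (Q : ℤ) with hl | hl
    · refine (hmod l (abs_le.1 hl) y z ?_).le
      have := dist_triangle_right y z c
      rw [Metric.mem_ball] at hyc hzc
      linarith
    · have := dist_triangle_right (σ l y) (σ l z) o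
      linarith [hy l hl, hz l hl]
  · intro z hz
    obtain ⟨c, hc, hzc⟩ := Set.mem_iUnion₂.1 (hcov (Set.mem_univ z))
    exact Set.mem_biUnion hc ⟨hz, hzc⟩

/-- Expansiveness with a uniform search radius, by compactness. With `g = f` it says that activity
has a cause at bounded distance. -/
theorem exists_far_of_le (h : IsZEndomorphism σ o f Δ) {g : Y → Y} (hg : Continuous g)
    (hgo : g o = o) {η : ℝ} (hη : 0 < η) :
    ∃ B : ℕ, ∀ y, η ≤ dist (g y) o → ∃ l : ℤ, |l| ≤ B ∧ Δ < dist (σ l y) o := by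
  have hK : IsCompact {y : Y | η ≤ dist (g y) o} :=
    (isClosed_le continuous_const (hg.dist continuous_const)).isCompact
  obtain ⟨B, hB⟩ := hK.elim_directed_cover
    (fun B : ℕ => ⋃ l : ℤ, ⋃ _ : |l| ≤ B, {y | Δ < dist (σ l y) o})
    (fun B => isOpen_iUnion fun l => isOpen_iUnion fun _ =>
      isOpen_lt continuous_const ((h.continuous_shift l).dist continuous_const))
    (by
      intro y hy
      obtain ⟨l, hl⟩ := h.exists_far (x := y) (by
        rintro rfl
        have : η ≤ 0 := by simpa [hgo] using hy
        linarith)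
      simp only [Set.mem_iUnion]
      exact ⟨l.natAbs, l, by simp, hl⟩)
    (directed_of_isDirected_le (by
      intro a b hab
      refine Set.iUnion_mono fun l => Set.iUnion_mono' fun hl => ⟨hl.trans ?_, le_rfl⟩
      exact_mod_cast hab))
  refine ⟨B, fun y hy => ?_⟩
  have := hB hy
  simp only [Set.mem_iUnion] at this
  obtain ⟨l, hl, hlt⟩ := this
  exact ⟨l, hl, hlt⟩

theorem tendsto_of_support (h : IsZEndomorphism σ o f Δ) {ε : ℝ} (hε : ε ≤ Δ) {Q : ℕ} {z : Y}
    (hz : ∀ l : ℤ, (Q : ℤ) < |l| → dist (σ l z) o ≤ ε) :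
    Tendsto (fun n => σ n z) cofinite (𝓝 o) := by
  rw [Metric.tendsto_nhds]
  intro η hη
  obtain ⟨B, hB⟩ := h.exists_far_of_le continuous_id rfl hη
  have hfin : (Set.Icc (-(Q + B : ℤ)) (Q + B)).Finite := Set.finite_Icc _ _
  filter_upwards [hfin.compl_mem_cofinite] with n hn
  by_contra! hle
  obtain ⟨l, hl, hlt⟩ := hB _ hle
  rw [← h.shift_add] at hlt
  refine hlt.not_ge ((hz _ ?_).trans hε)
  by_contra! hle'
  apply hn
  rw [abs_le] at hl hle'
  exact ⟨by omega, by omega⟩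

/-- Cluster points of `w` have support in the window `[-Q, Q]`, hence are finite in number. The
relation between consecutive terms survives in the limit, so `f` acts on them up to shifts, and some
orbit of this induced map is periodic. -/
theorem exists_spaceship_of_sequence (h : IsZEndomorphism σ o f Δ) {ε : ℝ} (hε0 : 0 < ε)
    (hε : 2 * ε ≤ Δ) {w : ℕ → Y} {c : ℕ → ℤ} {r Q : ℕ} (hc : ∀ m, |c m| ≤ r)
    (hw : ∀ m, f (w (m + 1)) = σ (c m) (w m)) (hfar : ∀ m, ε ≤ dist (w m) o)
    (hnear : ∀ B : ℕ, ∀ᶠ m in atTop, ∀ l : ℤ, (Q : ℤ) < |l| → |l| ≤ B → dist (σ l (w m)) o ≤ ε) :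
    ∃ p q z, IsSpaceship σ o f p q z := by
  let Z : Set Y := {z | MapClusterPt z atTop w}
  have hZsupp : ∀ z ∈ Z, ∀ l : ℤ, (Q : ℤ) < |l| → dist (σ l z) o ≤ ε := by
    intro z hz l hl
    obtain ⟨u, hu, huz⟩ := mapClusterPt_iff_ultrafilter.1 hz
    have h1 : Tendsto (fun m => dist (σ l (w m)) o) u (𝓝 (dist (σ l z) o)) :=
      (((h.continuous_shift l).tendsto z).comp huz).dist tendsto_const_nhds
    refine le_of_tendsto h1 (hu ?_)
    filter_upwards [hnear l.natAbs] with m hm using hm l hl (by simp)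
  have hZfar : ∀ z ∈ Z, ε ≤ dist z o := by
    intro z hz
    obtain ⟨u, hu, huz⟩ := mapClusterPt_iff_ultrafilter.1 hz
    exact ge_of_tendsto (huz.dist tendsto_const_nhds) (Eventually.of_forall hfar)
  have hfin : Z.Finite := (h.finite_support hε Q).subset hZsupp
  obtain ⟨z₀, hz₀⟩ : ∃ z, z ∈ Z := by
    obtain ⟨z, -, hz⟩ := (isCompact_univ (X := Y)).exists_clusterPt (f := map w atTop) (by simp)
    exact ⟨z, hz⟩
  have hstep : ∀ z : Z, ∃ z' : Z, ∃ d : ℤ, f z = σ d z' := by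
    rintro ⟨z, hz⟩
    obtain ⟨u, hu, huz⟩ := mapClusterPt_iff_ultrafilter.1 hz
    -- The index of `w` runs against time, so the image under `f` is governed by the preceding term
    -- `w (m - 1)`.
    obtain ⟨z', -, hz'⟩ := (isCompact_univ (X := Y)).ultrafilter_le_nhds
      (u.map fun m => w (m - 1)) (by simp)
    have hz't : Tendsto (fun m => w (m - 1)) u (𝓝 z') := hz'
    have hpred : Tendsto (fun m : ℕ => m - 1) u atTop := (tendsto_sub_atTop_nat 1).mono_left hu
    have hz'Z : z' ∈ Z := mapClusterPt_iff_ultrafilter.2 ⟨u.map (fun m => m - 1), hpred, hz't⟩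
    obtain ⟨d, -, hd⟩ : ∃ d ∈ Set.Icc (-r : ℤ) r, ∀ᶠ m in (u : Filter ℕ), c (m - 1) = d := by
      refine (Ultrafilter.eventually_exists_mem_iff (Set.finite_Icc (-r : ℤ) r)).1 ?_
      exact Eventually.of_forall fun m => ⟨_, abs_le.1 (hc (m - 1)), rfl⟩
    refine ⟨⟨z', hz'Z⟩, d, ?_⟩
    have h1 : Tendsto (fun m => f (w m)) u (𝓝 (f z)) := (h.continuous.tendsto z).comp huz
    have h2 : Tendsto (fun m => σ d (w (m - 1))) u (𝓝 (σ d z')) :=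
      ((h.continuous_shift d).tendsto z').comp hz't
    refine tendsto_nhds_unique h1 (h2.congr' ?_)
    filter_upwards [hd, hu (eventually_ge_atTop 1)] with m hm h1
    rw [← hm, ← hw, Nat.sub_add_cancel h1]
  choose g d hg using hstep
  have hiter : ∀ (k : ℕ) (z : Z), ∃ e : ℤ, f^[k] z = σ e (g^[k] z : Z) := by
    intro k
    induction k with
    | zero => exact fun z => ⟨0, by simp [h.shift_zero]⟩
    | succ k ih =>
      intro z
      obtain ⟨e, he⟩ := ih (g z)
      refine ⟨d z + e, ?_⟩
      rw [Function.iterate_succ_apply, Function.iterate_succ_apply, hg, h.iterate_comm, he,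
        h.shift_add]
  have := hfin.to_subtype
  obtain ⟨i, j, hij, heq⟩ : ∃ i j : ℕ, i < j ∧ g^[i] ⟨z₀, hz₀⟩ = g^[j] ⟨z₀, hz₀⟩ := by
    obtain ⟨i, j, hne, heq⟩ :=
      Finite.exists_ne_map_eq_of_infinite fun k : ℕ => g^[k] ⟨z₀, hz₀⟩
    rcases lt_or_gt_of_ne hne with hlt | hlt
    · exact ⟨i, j, hlt, heq⟩
    · exact ⟨j, i, hlt, heq.symm⟩
  obtain ⟨e, he⟩ := hiter (j - i) (g^[i] ⟨z₀, hz₀⟩)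
  rw [← Function.iterate_add_apply, Nat.sub_add_cancel hij.le, ← heq] at he
  have hz := (g^[i] ⟨z₀, hz₀⟩).2
  refine ⟨j - i, e, _, ?_, by omega, he, h.tendsto_of_support (by linarith) (hZsupp _ hz)⟩
  intro ho
  have := hZfar _ hz
  rw [ho, dist_self] at this
  linarith

/-- Compactness: the sequences that are trajectories from time `-n` on and far from `o` at time 0
form decreasing nonempty closed sets. -/
theorem exists_trajectory (h : IsZEndomorphism σ o f Δ) (hnil : ¬ ∃ n : ℕ, ∀ x, f^[n] x = o) :
    ∃ x ∈ trajectories f, Δ ≤ dist (x 0) o := by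
  let A : ℕ → Set (ℤ → Y) := fun n =>
    {x | (∀ k : ℤ, -n ≤ k → f (x k) = x (k + 1)) ∧ Δ ≤ dist (x 0) o}
  have hcl : ∀ n, IsClosed (A n) := by
    intro n
    have : {x : ℤ → Y | ∀ k : ℤ, -n ≤ k → f (x k) = x (k + 1)} =
        ⋂ k : ℤ, ⋂ _ : -(n : ℤ) ≤ k, {x | f (x k) = x (k + 1)} := by ext; simp
    refine IsClosed.inter (s₁ := {x : ℤ → Y | ∀ k : ℤ, -n ≤ k → f (x k) = x (k + 1)}) ?_
      (isClosed_le continuous_const ((continuous_apply 0).dist continuous_const))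
    rw [this]
    exact isClosed_iInter fun k => isClosed_iInter fun _ =>
      isClosed_eq (h.continuous.comp (continuous_apply k)) (continuous_apply (k + 1))
  obtain ⟨x, hx⟩ := IsCompact.nonempty_iInter_of_sequence_nonempty_isCompact_isClosed A
    (fun n x hx => ⟨fun k hk => hx.1 k (by push_cast; omega), hx.2⟩)
    (fun n => by
      push Not at hnil
      obtain ⟨y, hy⟩ := hnil n
      obtain ⟨l, hl⟩ := h.exists_far hy
      -- The orbit starts at time `-n`; truncation by `toNat` makes it constant before, where
      -- nothing is required.
      refine ⟨fun k => f^[(k + n).toNat] (σ l y), fun k hk => ?_, ?_⟩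
      · show f (f^[(k + n).toNat] (σ l y)) = f^[(k + 1 + n).toNat] (σ l y)
        rw [show (k + 1 + n).toNat = (k + n).toNat + 1 by omega, Function.iterate_succ_apply']
      · simpa [h.iterate_comm] using hl.le)
    (hcl 0).isCompact hcl
  rw [Set.mem_iInter] at hx
  exact ⟨x, fun n => (hx n.natAbs).1 n (by omega), (hx 0).2⟩

/-- Asking for one point `ε`-far at time 0 excludes the zero trajectory and is a closed condition,
so it survives intersections of chains. -/
theorem exists_minimal (h : IsZEndomorphism σ o f Δ) (hnil : ¬ ∃ n : ℕ, ∀ x, f^[n] x = o)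
    {ε : ℝ} (hε : ε ≤ Δ) :
    ∃ M : Set (ℤ → Y), Minimal (· ∈ {S : Set (ℤ → Y) | S ⊆ trajectories f ∧ IsClosed S ∧
      (∀ j n, ∀ x ∈ S, translate σ j n x ∈ S) ∧ ∃ x ∈ S, ε ≤ dist (x 0) o}) M := by
  have hfar : IsClosed {x : ℤ → Y | ε ≤ dist (x 0) o} :=
    isClosed_le continuous_const ((continuous_apply 0).dist continuous_const)
  have hmem : trajectories f ∈ {S : Set (ℤ → Y) | S ⊆ trajectories f ∧ IsClosed S ∧
      (∀ j n, ∀ x ∈ S, translate σ j n x ∈ S) ∧ ∃ x ∈ S, ε ≤ dist (x 0) o} := by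
    refine ⟨le_rfl, ?_, ?_, ?_⟩
    · have : trajectories f = ⋂ k : ℤ, {x | f (x k) = x (k + 1)} := by
        ext; simp [trajectories]
      rw [this]
      exact isClosed_iInter fun k =>
        isClosed_eq (h.continuous.comp (continuous_apply k)) (continuous_apply (k + 1))
    · intro j n x hx k
      simp only [translate]
      rw [h.comm, hx, add_right_comm]
    · obtain ⟨x, hx, hx'⟩ := h.exists_trajectory hnil
      exact ⟨x, hx, hε.trans hx'⟩
  obtain ⟨M, -, hM⟩ := zorn_superset_nonempty _ (fun c hc hchain hne => by
    refine ⟨⋂₀ c, ⟨?_, isClosed_sInter fun S hS => (hc hS).2.1, ?_, ?_⟩,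
      fun S hS => Set.sInter_subset_of_mem hS⟩
    · obtain ⟨S, hS⟩ := hne
      exact (Set.sInter_subset_of_mem hS).trans (hc hS).1
    · exact fun j n x hx S hS => (hc hS).2.2.1 j n x (hx S hS)
    · have : (⋂ S : c, (S : Set (ℤ → Y)) ∩ {x | ε ≤ dist (x 0) o}).Nonempty := by
        have := hne.to_subtype
        refine IsCompact.nonempty_iInter_of_directed_nonempty_isCompact_isClosed _ ?_ ?_ ?_ ?_
        · intro S S'
          rcases hchain.total S.2 S'.2 with hle | hle
          · exact ⟨S, le_rfl, Set.inter_subset_inter_left _ hle⟩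
          · exact ⟨S', Set.inter_subset_inter_left _ hle, le_rfl⟩
        · exact fun S => (hc S.2).2.2.2
        · exact fun S => ((hc S.2).2.1.inter hfar).isCompact
        · exact fun S => (hc S.2).2.1.inter hfar
      obtain ⟨x, hx⟩ := this
      rw [Set.mem_iInter] at hx
      obtain ⟨S, hS⟩ := hne
      exact ⟨x, fun S hS => (hx ⟨S, hS⟩).1, (hx ⟨S, hS⟩).2⟩) (trajectories f) hmem
  exact ⟨M, hM⟩

/-- An asymptotically nilpotent endomorphism of an expansive pointed `ℤ`-system that is not
nilpotent has a spaceship. -/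
theorem exists_spaceship (h : IsZEndomorphism σ o f Δ)
    (hasymp : ∀ x, Tendsto (fun n => f^[n] x) atTop (𝓝 o))
    (hnil : ¬ ∃ n : ℕ, ∀ x, f^[n] x = o) : ∃ p q z, IsSpaceship σ o f p q z := by
  have hΔ := h.pos
  set ε := Δ / 2 with hε
  have hε0 : 0 < ε := by positivity
  have hεΔ : ε ≤ Δ := by linarith
  obtain ⟨M, ⟨hMt, hMc, hMi, x₀, hx₀M, hx₀⟩, hMmin⟩ := h.exists_minimal hnil hεΔ
  have : CompactSpace M := isCompact_iff_compactSpace.1 hMc.isCompact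
  have : Nonempty M := ⟨⟨x₀, hx₀M⟩⟩
  let τ : ℤ → ℤ → M → M := fun j n x => ⟨translate σ j n x, hMi j n x x.2⟩
  let ν : M → ℝ := fun x => dist (x.1 0) o
  have hτ : ∀ j n, Continuous (τ j n) := fun j n =>
    Continuous.subtype_mk (continuous_pi fun k =>
      (h.continuous_shift j).comp ((continuous_apply (k + n)).comp continuous_subtype_val)) _
  have hν : Continuous ν :=
    ((continuous_apply 0).comp continuous_subtype_val).dist continuous_const
  have hadd : ∀ j n j' n' x, τ j n (τ j' n' x) = τ (j + j') (n + n') x := by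
    intro j n j' n' x
    refine Subtype.ext (funext fun k => ?_)
    simp only [τ, translate]
    rw [h.shift_add, add_assoc]
  have hντ : ∀ j n x, ν (τ j n x) = dist (σ j (x.1 n)) o := fun j n x => by
    simp [ν, τ, translate]
  have hmin : ∀ U : Set M, IsOpen U → U.Nonempty → ∀ x, 0 < ν x → ∃ j n, τ j n x ∈ U := by
    rintro U hU ⟨u, hu⟩ x hx
    by_contra! hno
    -- The points whose orbits avoid `U` form a closed invariant set. It contains `x`, and by
    -- expansiveness a translate of `x` that is far at time 0, so minimality would make it all of
    -- `M`.
    let S : Set M := {y | ∀ j n, τ j n y ∉ U}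
    have hS : IsClosed S := by
      have : S = ⋂ j : ℤ, ⋂ n : ℤ, (τ j n ⁻¹' U)ᶜ := by ext; simp [S]
      rw [this]
      exact isClosed_iInter fun j => isClosed_iInter fun n =>
        (hU.preimage (hτ j n)).isClosed_compl
    have hxo : x.1 0 ≠ o := dist_pos.1 hx
    obtain ⟨l, hl⟩ := h.exists_far hxo
    have hSi : ∀ j n, ∀ y ∈ S, τ j n y ∈ S := fun j n y hy j' n' => by
      rw [hadd]; exact hy _ _
    have := hMmin (y := Subtype.val '' S)
      ⟨(Subtype.coe_image_subset M S).trans hMt, hMc.isClosedEmbedding_subtypeVal.isClosedMap _ hS,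
        by
          rintro j n _ ⟨y, hy, rfl⟩
          exact ⟨τ j n y, hSi j n y hy, rfl⟩,
        (τ l 0 x).1, ⟨_, hSi l 0 x hno, rfl⟩, by
          have := hντ l 0 x
          simp only [ν] at this
          rw [this]
          linarith⟩ (Subtype.coe_image_subset M S)
    obtain ⟨y, hy, hyu⟩ := this u.2
    have hyu : y = u := Subtype.ext hyu
    refine hy 0 0 ?_
    have : τ 0 0 y = y := Subtype.ext (funext fun k => by simp [τ, translate, h.shift_zero])
    rwa [this, hyu]
  have hiter : ∀ (x : M) (n : ℕ), x.1 n = f^[n] (x.1 0) := by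
    intro x n
    induction n with
    | zero => simp
    | succ n ih => rw [Function.iterate_succ_apply', ← ih, hMt x.2 n]; push_cast; rfl
  have hlim : ∀ x, Tendsto (fun n : ℕ => ν (τ 0 n x)) atTop (𝓝 0) := by
    intro x
    have := (hasymp (x.1 0)).dist (tendsto_const_nhds (x := o))
    rw [dist_self] at this
    refine this.congr fun n => ?_
    rw [hντ, h.shift_zero, hiter]
  have hcol : ∀ x, ∀ η : ℝ, 0 < η → {n : ℤ | η ≤ ν (τ 0 n x)}.Finite := fun x η hη =>
    finite_column hτ hν hadd hmin hlim ⟨⟨x₀, hx₀M⟩, hε0.trans_le hx₀⟩ x hη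
  obtain ⟨r, hr⟩ := h.exists_far_of_le h.continuous h.map_base hε0
  obtain ⟨K, D, hKD⟩ := exists_wall hτ hν hadd hmin hcol r hε0
  obtain ⟨a, has, ha, hthin⟩ := exists_thin_path (r := r) (K := K) (D := D)
    (N := fun j n => ε ≤ ν (τ j n ⟨x₀, hx₀M⟩))
    (fun j n hN => by
      rw [hντ] at hN
      have e : x₀ n = f (x₀ (n - 1)) := by rw [hMt hx₀M]; simp
      simp only at hN
      rw [e, ← h.comm] at hN
      obtain ⟨l, hl, hl'⟩ := hr _ hN
      refine ⟨l + j, by simpa using hl, ?_⟩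
      rw [hντ, h.shift_add]
      exact hεΔ.trans hl'.le)
    (fun j n hN => by
      obtain ⟨i, hi, hz⟩ := hKD _ hN
      refine ⟨i + j, by simpa using hi, fun j' n' hj' hn' => ?_⟩
      have := hz (j' - j) (n' - n) (by convert hj' using 2; ring) hn'
      rw [hadd, sub_add_cancel, sub_add_cancel] at this
      exact not_le.2 this)
    (fun j => by
      have := hcol (τ j 0 ⟨x₀, hx₀M⟩) ε hε0
      simpa [hadd] using this)
    (by rw [hντ, h.shift_zero]; exact hx₀)
  -- The diagram is viewed from the moving position `a m` at time `-m`.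
  refine h.exists_spaceship_of_sequence hε0 (by linarith)
    (w := fun m => σ (a m) (x₀ (-m))) (c := fun m => a (m + 1) - a m) (r := r)
    (Q := K + r + r * D) has (fun m => ?_) (fun m => ?_) (fun B => ?_)
  · rw [h.comm, hMt hx₀M, ← h.shift_add, sub_add_cancel]
    congr 2
    push_cast
    ring
  · have := ha m
    rwa [hντ] at this
  · filter_upwards [hthin B] with m hm l hl hl'
    have := hm (l + a m) (by simpa using hl) (by simpa using hl')
    rw [hντ, h.shift_add] at this
    exact (not_le.1 this).le

end IsZEndomorphism

/-! ### Recurrent configurations of spaceships -/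

/-- The maps `σ n` act on the closed set `W` and on a set `S` containing all `f`-trajectories
of points of `W`; the action is expansive on `S`, commutes with `f` along these trajectories,
and `f` is asymptotically nilpotent on `W`. -/
structure IsPartialZSystem {X : Type*} [MetricSpace X] (σ : ℤ → X → X) (o : X) (f : X → X)
    (W S : Set X) (Δ : ℝ) : Prop where
  shift_zero : ∀ x, σ 0 x = x
  shift_add : ∀ m n x, σ (m + n) x = σ m (σ n x)
  shift_base : ∀ n, σ n o = o
  isClosed : IsClosed W
  base_mem : o ∈ W
  shift_mem : ∀ n, ∀ x ∈ W, σ n x ∈ W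
  continuousOn_shift : ∀ n, ContinuousOn (σ n) W
  continuous : Continuous f
  iterate_mem : ∀ k, ∀ x ∈ W, f^[k] x ∈ S
  shift_mem_ambient : ∀ n, ∀ x ∈ S, σ n x ∈ S
  iterate_comm : ∀ k n, ∀ x ∈ W, f^[k] (σ n x) = σ n (f^[k] x)
  asymp : ∀ x ∈ W, Tendsto (fun n => f^[n] x) atTop (𝓝 o)
  pos : 0 < Δ
  expansive : ∀ x ∈ S, ∀ y ∈ S, (∀ n, dist (σ n x) (σ n y) ≤ Δ) → x = y

/-- The orbit of `y` follows translates of points of the orbit of `x`, up to maps in `Γ`: at time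
`n` it is `ε`-close to `g n (σ (n - a n) x)`. -/
structure IsShadowing {X : Type*} [MetricSpace X] (σ : ℤ → X → X) (Γ : Set (X → X)) (x : X)
    (ε : ℝ) (y : X) (a : ℤ → ℤ) (g : ℤ → X → X) : Prop where
  mem : ∀ n, g n ∈ Γ
  anchor : ∀ n, a (a n) = a n
  map_anchor : ∀ n, g (a n) = g n
  dist_lt : ∀ n, dist (σ n y) (g n (σ (n - a n) x)) < ε

/-- The finite set `Γ` of maps preserving `W` commutes with `f` on the orbit of `x`. -/
structure IsSymmetrySet {X : Type*} [MetricSpace X] (σ : ℤ → X → X) (o : X) (f : X → X)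
    (W : Set X) (x : X) (Γ : Set (X → X)) : Prop where
  finite : Γ.Finite
  map_base : ∀ γ ∈ Γ, γ o = o
  continuousWithinAt : ∀ γ ∈ Γ, ContinuousWithinAt γ W o
  eq_base : ∀ γ ∈ Γ, ∀ u ∈ W, γ u = o → u = o
  comm : ∀ γ ∈ Γ, ∀ k n, f^[k] (γ (σ n x)) = γ (f^[k] (σ n x))

namespace IsPartialZSystem

variable {X : Type*} [MetricSpace X] {σ : ℤ → X → X} {o : X} {f : X → X} {W S : Set X} {Δ : ℝ}

/-- The orbit of `o` converges to `o`, so by continuity `o` is fixed. -/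
theorem map_base (h : IsPartialZSystem σ o f W S Δ) : f o = o := by
  have h1 := h.asymp o h.base_mem
  have h2 := (h.continuous.tendsto o).comp h1
  have h3 := h1.comp (tendsto_add_atTop_nat 1)
  refine tendsto_nhds_unique (h2.congr fun n => ?_) h3
  simp only [Function.comp_apply, Function.iterate_succ_apply']

theorem iterate_base (h : IsPartialZSystem σ o f W S Δ) (k : ℕ) : f^[k] o = o :=
  Function.iterate_fixed h.map_base k

theorem mem_ambient (h : IsPartialZSystem σ o f W S Δ) {x : X} (hx : x ∈ W) : x ∈ S :=
  h.iterate_mem 0 x hx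

theorem shift_neg_shift (h : IsPartialZSystem σ o f W S Δ) (n : ℤ) (x : X) :
    σ (-n) (σ n x) = x := by
  rw [← h.shift_add, neg_add_cancel, h.shift_zero]

theorem shift_injective (h : IsPartialZSystem σ o f W S Δ) (n : ℤ) :
    Function.Injective (σ n) :=
  Function.LeftInverse.injective (h.shift_neg_shift n)

theorem shift_eq_base (h : IsPartialZSystem σ o f W S Δ) {n : ℤ} {x : X} :
    σ n x = o ↔ x = o :=
  ⟨fun hx => h.shift_injective n (hx.trans (h.shift_base n).symm),
    fun hx => by rw [hx, h.shift_base]⟩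

theorem iterate_mul (h : IsPartialZSystem σ o f W S Δ) {P : ℕ} {Q : ℤ} {y : X} (hy : y ∈ W)
    (hPQ : f^[P] y = σ Q y) (k : ℕ) : f^[P * k] y = σ (k * Q) y := by
  induction k with
  | zero => simp [h.shift_zero]
  | succ k ih =>
    rw [mul_add, mul_one, Function.iterate_add_apply, hPQ, h.iterate_comm _ _ _ hy, ih,
      ← h.shift_add]
    congr 1
    push_cast
    ring

theorem ne_zero_of_iterate_eq (h : IsPartialZSystem σ o f W S Δ) {P : ℕ} (hP : 0 < P) {Q : ℤ}
    {y : X} (hy : y ∈ W) (hyo : y ≠ o) (hPQ : f^[P] y = σ Q y) : Q ≠ 0 := by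
  rintro rfl
  have h1 : Tendsto (fun k : ℕ => f^[P * k] y) atTop (𝓝 o) :=
    (h.asymp y hy).comp (tendsto_id.const_mul_atTop' hP)
  simp only [h.iterate_mul hy hPQ, mul_zero, h.shift_zero] at h1
  exact hyo (tendsto_nhds_unique tendsto_const_nhds h1)

/-- A point which is translated by `Q` under `f^[P]` has its orbit tend to `o` in the direction
of `Q`. -/
theorem finite_far (h : IsPartialZSystem σ o f W S Δ) {P : ℕ} (hP : 0 < P) {Q : ℤ} (hQ : Q ≠ 0)
    {y : X} (hy : y ∈ W) (hPQ : f^[P] y = σ Q y) {η : ℝ} (hη : 0 < η) :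
    {n : ℤ | n.sign = Q.sign ∧ η ≤ dist (σ n y) o}.Finite := by
  have h1 : Tendsto (fun k : ℕ => σ (k * Q) y) atTop (𝓝[W] o) := by
    refine tendsto_nhdsWithin_iff.2 ⟨?_, Eventually.of_forall fun k => h.shift_mem _ _ hy⟩
    refine ((h.asymp y hy).comp (tendsto_id.const_mul_atTop' hP)).congr fun k => ?_
    exact h.iterate_mul hy hPQ k
  have h2 : ∀ᶠ k : ℕ in atTop, ∀ r ∈ Finset.range Q.natAbs,
      dist (σ (r : ℤ) (σ (k * Q) y)) o < η := by
    refine (Finset.eventually_all _).2 fun r _ => ?_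
    have h3 := (h.continuousOn_shift r o h.base_mem).tendsto.comp h1
    rw [h.shift_base] at h3
    exact (Metric.tendsto_nhds.1 h3) η hη
  obtain ⟨k₀, hk₀⟩ := eventually_atTop.1 h2
  refine (((Finset.range k₀ ×ˢ Finset.range Q.natAbs).image
    fun x : ℕ × ℕ => (x.2 : ℤ) + x.1 * Q).finite_toSet).subset ?_
  rintro n ⟨hs, hn⟩
  have hmod := Int.emod_nonneg n hQ
  have hlt := Int.emod_lt_abs n hQ
  -- As `n` and `Q` have the same sign, `n = r + k * Q` with `k ≥ 0` and `0 ≤ r < |Q|`, so only the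
  -- finitely many shifts by `r` need control.
  have hdiv : 0 ≤ n / Q := by
    by_contra! hneg
    have e := Int.mul_ediv_add_emod n Q
    rcases lt_or_gt_of_ne hQ with hQ' | hQ'
    · rw [Int.sign_eq_neg_one_of_neg hQ', Int.sign_eq_neg_one_iff_neg] at hs
      nlinarith
    · rw [Int.sign_eq_one_of_pos hQ', Int.sign_eq_one_iff_pos] at hs
      rw [abs_of_pos hQ'] at hlt
      nlinarith
  obtain ⟨k, hk⟩ := Int.eq_ofNat_of_zero_le hdiv
  obtain ⟨r, hr⟩ := Int.eq_ofNat_of_zero_le hmod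
  have hrQ : r < Q.natAbs := by rw [Int.abs_eq_natAbs] at hlt; omega
  have hnn : n = r + k * Q := by
    have := Int.mul_ediv_add_emod n Q
    rw [hk, hr] at this
    rw [← this]; ring
  simp only [Finset.coe_image, Set.mem_image, SetLike.mem_coe, Finset.mem_product,
    Finset.mem_range, Prod.exists]
  refine ⟨k, r, ⟨?_, hrQ⟩, hnn.symm⟩
  by_contra! hle
  have := hk₀ k hle r (Finset.mem_range.2 hrQ)
  rw [← h.shift_add, ← hnn] at this
  linarith

/-- A periodic point has a finite orbit, on which `f^[k]` tends to `o` uniformly; expansiveness then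
gives `f^[k] z = o` for all large `k`. -/
theorem not_periodic (h : IsPartialZSystem σ o f W S Δ) {z : X} (hz : z ∈ W)
    (hne : ∃ᶠ k in atTop, f^[k] z ≠ o) {d : ℤ} (hd : d ≠ 0) : σ d z ≠ z := by
  intro hper
  have h2 : ∀ᶠ k : ℕ in atTop, ∀ r ∈ Finset.range d.natAbs,
      dist (f^[k] (σ (r : ℤ) z)) o < Δ := by
    refine (Finset.eventually_all _).2 fun r _ => ?_
    exact (Metric.tendsto_nhds.1 (h.asymp _ (h.shift_mem r z hz))) Δ h.pos
  obtain ⟨k, hk, hk'⟩ := (hne.and_eventually h2).exists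
  have hmul : ∀ m : ℕ, σ (d * m) z = z := by
    intro m
    induction m with
    | zero => simp [h.shift_zero]
    | succ m ih => rw [Nat.cast_succ, mul_add, mul_one, h.shift_add, hper, ih]
  have hmulz : ∀ m : ℤ, σ (d * m) z = z := by
    intro m
    obtain ⟨m, rfl | rfl⟩ := Int.eq_nat_or_neg m
    · exact hmul m
    · refine h.shift_injective (d * m) ?_
      rw [← h.shift_add, ← mul_add, add_neg_cancel, mul_zero, h.shift_zero, hmul]
  refine hk (h.expansive _ (h.iterate_mem k z hz) o (h.mem_ambient h.base_mem) fun n => ?_)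
  obtain ⟨r, hr⟩ := Int.eq_ofNat_of_zero_le (Int.emod_nonneg n hd)
  have hlt := Int.emod_lt_abs n hd
  have e : σ n z = σ (r : ℤ) z := by
    conv_lhs => rw [← Int.emod_add_mul_ediv n d, h.shift_add, hmulz, hr]
  rw [h.shift_base, ← h.iterate_comm _ _ _ hz, e]
  exact (hk' r (Finset.mem_range.2 (by rw [Int.abs_eq_natAbs] at hlt; omega))).le

/-- Limits of points shadowing a spaceship are spaceships of the same speed. -/
theorem iterate_eq_of_limit (h : IsPartialZSystem σ o f W S Δ) {p : ℕ} {q : ℤ} {x : X}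
    (hx : IsZEndomorphism.IsSpaceship σ o f p q x) (hxW : x ∈ W) {Γ : Set (X → X)}
    (hΓ : IsSymmetrySet σ o f W x Γ) {U : Ultrafilter ℕ} {y : ℕ → X} (hyW : ∀ k, y k ∈ W)
    {a : ℕ → ℤ → ℤ} {g : ℕ → ℤ → X → X} {ε : ℕ → ℝ} (hε : Tendsto ε U (𝓝 0))
    (hsh : ∀ k, IsShadowing σ Γ x (ε k) (y k) (a k) (g k)) {z : X}
    (hz : Tendsto y U (𝓝 z)) (hzo : z ≠ o) :
    f^[p * (hΓ.finite.toFinset.card).factorial] z =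
      σ (((hΓ.finite.toFinset.card).factorial : ℕ) * q) z := by
  obtain ⟨hxo, hp, hpq, hhom⟩ := hx
  have hzW : z ∈ W := h.isClosed.mem_of_tendsto hz (Eventually.of_forall hyW)
  have hyz : Tendsto y U (𝓝[W] z) := tendsto_nhdsWithin_iff.2 ⟨hz, Eventually.of_forall hyW⟩
  have hσz : ∀ m, Tendsto (fun k => σ m (y k)) U (𝓝 (σ m z)) := fun m =>
    (h.continuousOn_shift m z hzW).tendsto.comp hyz
  have hdist : ∀ m, Tendsto (fun k => dist (σ m (y k)) (g k m (σ (m - a k m) x))) U (𝓝 0) :=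
    fun m => squeeze_zero (fun k => dist_nonneg) (fun k => ((hsh k).dist_lt m).le) hε
  have hclose : ∀ m, Tendsto (fun k => g k m (σ (m - a k m) x)) U (𝓝 (σ m z)) := by
    intro m
    refine (hσz m).congr_dist (hdist m)
  -- Along the ultrafilter both the symmetry and the anchor stabilize: an escaping anchor would make
  -- the homoclinic copy of `x` vanish at `m`, forcing `z = o`.
  have hst : ∀ m, ∃ γ ∈ Γ, ∃ b, ∀ᶠ k in (U : Filter ℕ), g k m = γ ∧ a k m = b := by
    intro m
    obtain ⟨γ, hγ, hγU⟩ : ∃ γ ∈ Γ, ∀ᶠ k in (U : Filter ℕ), g k m = γ :=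
      (Ultrafilter.eventually_exists_mem_iff hΓ.finite).1
        (Eventually.of_forall fun k => ⟨_, (hsh k).mem m, rfl⟩)
    refine ⟨γ, hγ, ?_⟩
    by_contra! hno
    have hb : ∀ b, ∀ᶠ k in (U : Filter ℕ), a k m ≠ b := by
      intro b
      filter_upwards [hno b, hγU] with k h1 h2 using h1 h2
    have hcof : Tendsto (fun k => m - a k m) U cofinite := by
      refine le_cofinite_iff_eventually_ne.2 fun b => ?_
      rw [eventually_map]
      filter_upwards [hb (m - b)] with k hk hk'
      exact hk (by omega)
    have h1 : Tendsto (fun k => σ (m - a k m) x) U (𝓝[W] o) :=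
      tendsto_nhdsWithin_iff.2 ⟨hhom.comp hcof, Eventually.of_forall fun k => h.shift_mem _ _ hxW⟩
    have h2 := (hΓ.continuousWithinAt γ hγ).tendsto.comp h1
    rw [hΓ.map_base γ hγ] at h2
    refine hzo (h.shift_eq_base.1 (tendsto_nhds_unique (hclose m) (h2.congr' ?_)))
    filter_upwards [hγU] with k hk
    rw [hk]; rfl
  choose γ hγ b hb using hst
  have hform : ∀ m, σ m z = γ m (σ (m - b m) x) := by
    intro m
    refine tendsto_nhds_unique (hclose m) (tendsto_const_nhds.congr' ?_)
    filter_upwards [hb m] with k hk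
    rw [hk.1, hk.2]
  have hanch : ∀ m, σ (b m) z = γ m x := by
    intro m
    refine tendsto_nhds_unique (hclose (b m)) (tendsto_const_nhds.congr' ?_)
    filter_upwards [hb m] with k hk
    have h1 := (hsh k).anchor m
    have h2 := (hsh k).map_anchor m
    rw [hk.2] at h1 h2
    rw [h1, h2, hk.1, sub_self, h.shift_zero]
  have hxiter : ∀ (k : ℕ) (n : ℤ), f^[p * k] (σ n x) = σ (n + k * q) x := by
    intro k n
    rw [h.iterate_comm _ _ _ hxW, h.iterate_mul hxW hpq, ← h.shift_add]
  have hziter : ∀ (k : ℕ) (m : ℤ), f^[p * k] (σ m z) = γ m (σ (m - b m + k * q) x) := by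
    intro k m
    rw [hform, hΓ.comm _ (hγ m), hxiter]
  have hper : ∀ d : ℤ, d ≠ 0 → σ d z ≠ z := by
    intro d hd
    refine h.not_periodic hzW ?_ hd
    rw [frequently_atTop]
    intro k
    refine ⟨p * k, Nat.le_mul_of_pos_left k hp, fun ho => ?_⟩
    have := hziter k 0
    rw [h.shift_zero, ho] at this
    exact hxo (h.shift_eq_base.1 (hΓ.eq_base _ (hγ 0) _ (h.shift_mem _ _ hxW) this.symm))
  -- The same symmetry at two anchors makes `z` return to the same point `γ x`, so the anchors agree
  -- because `z` is not periodic.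
  have hbγ : ∀ m m', γ m = γ m' → b m = b m' := by
    intro m m' hmm
    by_contra hne
    refine hper (b m - b m') (by omega) (h.shift_injective (b m') ?_)
    rw [← h.shift_add, add_sub_cancel, hanch, hanch, hmm]
  set c := hΓ.finite.toFinset.card
  -- Among times `0, q, …, c * q` two use the same symmetry, hence the same anchor. Between them `z`
  -- moves like `x`. The gap is at most `c`, so the factorial is a common multiple of all possible
  -- gaps.
  obtain ⟨i, hi, j, hj, hij, heq⟩ : ∃ i ∈ Finset.range (c + 1), ∃ j ∈ Finset.range (c + 1),
      i < j ∧ γ (i * q) = γ (j * q) := by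
    obtain ⟨i, hi, j, hj, hne, heq⟩ := Finset.exists_ne_map_eq_of_card_lt_of_maps_to
      (s := Finset.range (c + 1)) (t := hΓ.finite.toFinset) (f := fun i : ℕ => γ (i * q))
      (by rw [Finset.card_range]; omega) (fun i _ => by simpa using hγ _)
    rcases lt_or_gt_of_ne hne with hlt | hlt
    · exact ⟨i, hi, j, hj, hlt, heq⟩
    · exact ⟨j, hj, i, hi, hlt, heq.symm⟩
  rw [Finset.mem_range] at hi hj
  have hk : f^[p * (j - i)] z = σ ((j - i : ℕ) * q) z := by
    refine h.shift_injective (i * q) ?_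
    rw [← h.iterate_comm _ _ _ hzW, hziter, ← h.shift_add, heq, hbγ _ _ heq, ← add_mul]
    rw [show ((i : ℤ) + (j - i : ℕ)) = j by omega, hform]
    congr 2
    rw [Nat.cast_sub hij.le]
    ring
  obtain ⟨l, hl⟩ : j - i ∣ c.factorial := Nat.dvd_factorial (by omega) (by omega)
  have := h.iterate_mul hzW hk l
  rw [mul_assoc, ← hl] at this
  rw [this, hl]
  congr 1
  push_cast
  ring

/-- There is no recurrent shadowing of a spaceship. -/
theorem not_recurrent (h : IsPartialZSystem σ o f W S Δ) [CompactSpace X] {p : ℕ} {q : ℤ} {x : X}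
    (hx : IsZEndomorphism.IsSpaceship σ o f p q x) (hxW : x ∈ W) {Γ : Set (X → X)}
    (hΓ : IsSymmetrySet σ o f W x Γ) :
    ¬ ∀ ε : ℝ, 0 < ε → ∀ c : ℤ, c = 1 ∨ c = -1 → ∃ y ∈ W, ∃ (a : ℤ → ℤ) (g : ℤ → X → X),
      IsShadowing σ Γ x ε y a g ∧ {n | a n = n ∧ n.sign = c}.Infinite := by
  intro hrec
  have hq : q ≠ 0 := h.ne_zero_of_iterate_eq hx.2.1 hxW hx.1 hx.2.2.1
  set P := (hΓ.finite.toFinset.card).factorial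
  have hP0 : 0 < P := Nat.factorial_pos _
  -- Otherwise, counterexamples with `ε → 0` violate the relation by more than `Δ` at some time.
  -- Recentred there, they converge to a nonzero limit that still violates it, against
  -- `iterate_eq_of_limit`.
  obtain ⟨ε₀, hε₀, hgood⟩ : ∃ ε₀ : ℝ, 0 < ε₀ ∧ ∀ y ∈ W, ∀ (a : ℤ → ℤ) (g : ℤ → X → X),
      IsShadowing σ Γ x ε₀ y a g → f^[p * P] y = σ (P * q) y := by
    by_contra! hbad
    have : Nonempty X := ⟨o⟩
    choose! y hyW a g hsh hne using hbad
    have hfar : ∀ ε, 0 < ε → ∃ n, Δ < dist (f^[p * P] (σ n (y ε))) (σ (P * q) (σ n (y ε))) := by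
      intro ε hε
      by_contra! hle
      refine hne ε hε (h.expansive _ (h.iterate_mem _ _ (hyW ε hε)) _
        (h.mem_ambient (h.shift_mem _ _ (hyW ε hε))) fun n => ?_)
      rw [← h.iterate_comm _ _ _ (hyW ε hε), ← h.shift_add, add_comm n, h.shift_add]
      exact hle n
    choose! n hn using hfar
    let e : ℕ → ℝ := fun k => 1 / ((k : ℝ) + 1)
    have he : ∀ k, 0 < e k := fun k => Nat.one_div_pos_of_nat
    have helim : Tendsto e (hyperfilter ℕ : Filter ℕ) (𝓝 0) :=
      tendsto_one_div_add_atTop_nhds_zero_nat.mono_left Nat.hyperfilter_le_atTop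
    let y' : ℕ → X := fun k => σ (n (e k)) (y (e k))
    have hy'W : ∀ k, y' k ∈ W := fun k => h.shift_mem _ _ (hyW _ (he k))
    obtain ⟨z, -, hz⟩ := (isCompact_univ (X := X)).ultrafilter_le_nhds
      ((hyperfilter ℕ).map y') (by simp)
    have hz' : Tendsto y' (hyperfilter ℕ : Filter ℕ) (𝓝 z) := hz
    have hzW : z ∈ W := h.isClosed.mem_of_tendsto hz' (Eventually.of_forall hy'W)
    have hyz : Tendsto y' (hyperfilter ℕ : Filter ℕ) (𝓝[W] z) :=
      tendsto_nhdsWithin_iff.2 ⟨hz', Eventually.of_forall hy'W⟩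
    have hlim : Δ ≤ dist (f^[p * P] z) (σ (P * q) z) := by
      refine ge_of_tendsto ((((h.continuous.iterate (p * P)).tendsto z).comp hz').dist
        ((h.continuousOn_shift (P * q) z hzW).tendsto.comp hyz)) ?_
      exact Eventually.of_forall fun k => (hn _ (he k)).le
    have hpos := h.pos
    have hzo : z ≠ o := by
      rintro rfl
      rw [h.iterate_base, h.shift_base, dist_self] at hlim
      linarith
    rw [h.iterate_eq_of_limit hx hxW hΓ (U := hyperfilter ℕ) (y := y') (ε := e) hy'W
      (a := fun k m => a (e k) (m + n (e k)) - n (e k))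
      (g := fun k m => g (e k) (m + n (e k))) helim (fun k => ?_) hz' hzo, dist_self] at hlim
    · linarith
    · have := hsh _ (he k)
      refine ⟨fun m => this.mem _, fun m => ?_, fun m => ?_, fun m => ?_⟩
      · rw [sub_add_cancel, this.anchor]
      · rw [sub_add_cancel, this.map_anchor]
      · have h1 := this.dist_lt (m + n (e k))
        rw [h.shift_add] at h1
        convert h1 using 4
        ring
  -- All images of `x` under the finite set `Γ` stay at least `κ` from `o`, so each return to an
  -- anchor is visibly far from `o`.
  obtain ⟨κ, hκ, hκΓ⟩ : ∃ κ : ℝ, 0 < κ ∧ ∀ γ ∈ Γ, κ ≤ dist (γ x) o := by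
    rcases Γ.eq_empty_or_nonempty with rfl | hne
    · exact ⟨1, one_pos, by simp⟩
    · obtain ⟨γ, hγ, hmin⟩ := Set.exists_min_image Γ (fun γ => dist (γ x) o) hΓ.finite hne
      exact ⟨dist (γ x) o, dist_pos.2 fun ho => hx.1 (hΓ.eq_base γ hγ x hxW ho), hmin⟩
  obtain ⟨y, hyW, a, g, hsh, hinf⟩ := hrec (min ε₀ (κ / 2)) (lt_min hε₀ (half_pos hκ)) q.sign
    (by rcases lt_or_gt_of_ne hq with hq' | hq'
        · exact Or.inr (Int.sign_eq_neg_one_of_neg hq')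
        · exact Or.inl (Int.sign_eq_one_of_pos hq'))
  have hy := hgood y hyW a g ⟨hsh.mem, hsh.anchor, hsh.map_anchor, fun n =>
    (hsh.dist_lt n).trans_le (min_le_left _ _)⟩
  have hPq : (P : ℤ) * q ≠ 0 := mul_ne_zero (by exact_mod_cast hP0.ne') hq
  refine hinf ((h.finite_far (Nat.mul_pos hx.2.1 hP0) hPq hyW hy (half_pos hκ)).subset ?_)
  rintro n ⟨han, hs⟩
  refine ⟨?_, ?_⟩
  · rw [Int.sign_mul, Int.sign_natCast_of_ne_zero hP0.ne', one_mul]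
    exact hs
  · have h1 := (hsh.dist_lt n).trans_le (min_le_right _ _)
    rw [han, sub_self, h.shift_zero] at h1
    have h2 := hκΓ _ (hsh.mem n)
    have h3 := dist_triangle_left (g n x) o (σ n y)
    linarith

/-- An asymptotically nilpotent endomorphism does not admit spaceships in an expansive pointed
`ℤ`-system in which every homoclinic point can be repeated infinitely often. -/
theorem not_repeated (h : IsPartialZSystem σ o f Set.univ Set.univ Δ) [CompactSpace X] {p : ℕ}
    {q : ℤ} {x : X} (hx : IsZEndomorphism.IsSpaceship σ o f p q x) :
    ¬ ∀ ε : ℝ, 0 < ε → ∀ c : ℤ, c = 1 ∨ c = -1 → ∃ y,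
      (∀ n : ℤ, ∃ k : ℤ, dist (σ n y) (σ k x) < ε) ∧
      {n : ℤ | n.sign = c ∧ dist (σ n y) x < ε}.Infinite := by
  intro hrec
  have hu : ∀ y : X, y ∈ Set.univ := Set.mem_univ
  have hq : q ≠ 0 := h.ne_zero_of_iterate_eq hx.2.1 (hu x) hx.1 hx.2.2.1
  have hpos := h.pos
  obtain ⟨ε₁, hε₁, h₁⟩ := exists_modulus (fun _ : Unit => h.continuous.iterate p)
    (Set.finite_univ) (half_pos hpos)
  obtain ⟨ε₂, hε₂, h₂⟩ := exists_modulus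
    (fun _ : Unit => continuousOn_univ.1 (h.continuousOn_shift q)) (Set.finite_univ)
    (half_pos hpos)
  have hκ : 0 < dist x o := dist_pos.2 hx.1
  obtain ⟨y, hnear, hinf⟩ := hrec (min (min ε₁ ε₂) (dist x o / 2))
    (lt_min (lt_min hε₁ hε₂) (half_pos hκ)) q.sign
    (by rcases lt_or_gt_of_ne hq with hq' | hq'
        · exact Or.inr (Int.sign_eq_neg_one_of_neg hq')
        · exact Or.inl (Int.sign_eq_one_of_pos hq'))
  -- The relation holds exactly on the orbit of `x`, which every `σ n y` approximates, so it holds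
  -- for `y` up to `Δ` at all times.
  have hy : f^[p] y = σ q y := by
    refine h.expansive _ (hu _) _ (hu _) fun n => ?_
    obtain ⟨k, hk⟩ := hnear n
    have hk' := hk.trans_le (min_le_left _ _)
    have e1 := h₁ () trivial _ _ (hk'.trans_le (min_le_left _ _))
    have e2 := h₂ () trivial _ _ (hk'.trans_le (min_le_right _ _))
    rw [h.iterate_comm _ _ _ (hu _), h.iterate_comm _ _ _ (hu _), hx.2.2.1] at e1
    rw [← h.shift_add, ← h.shift_add, add_comm q, add_comm q, h.shift_add, h.shift_add] at e2
    have := dist_triangle_right (σ n (f^[p] y)) (σ n (σ q y)) (σ k (σ q x))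
    linarith
  refine hinf ((h.finite_far hx.2.1 hq (hu y) hy (half_pos hκ)).subset ?_)
  rintro n ⟨hs, hn⟩
  refine ⟨hs, ?_⟩
  have h1 := hn.trans_le (min_le_right _ _)
  have h3 := dist_triangle_left x o (σ n y)
  linarith

end IsPartialZSystem

/-! ### Syndetic copies of `ℤ` -/

section Syndetic

variable {G G' : Type*} [Group G] [Group G']

/-- Finitely many translates of the range of `ψ` cover the group. -/
def IsSyndetic (ψ : Multiplicative ℤ →* G) : Prop :=
  ∃ F : Set G, F.Finite ∧ ∀ g, ∃ a ∈ F, ∃ n, g = a * ψ n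

theorem isSyndetic_of_finiteIndex {H : Subgroup G} [H.FiniteIndex] (e : Multiplicative ℤ ≃* H) :
    IsSyndetic (H.subtype.comp e.toMonoidHom) := by
  have : Finite (Quotient (QuotientGroup.leftRel H)) :=
    Subgroup.finite_quotient_of_finiteIndex (H := H)
  refine ⟨Set.range (Quotient.out : G ⧸ H → G), Set.finite_range _, fun g => ?_⟩
  obtain ⟨k, hk⟩ := QuotientGroup.mk_out_eq_mul H g
  refine ⟨_, ⟨(g : G ⧸ H), rfl⟩, e.symm k⁻¹, ?_⟩
  rw [hk]
  simp

theorem IsSyndetic.of_comp {ψ : Multiplicative ℤ →* G} {χ : Multiplicative ℤ →* G'}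
    {φ : G' →* G} (hψ : IsSyndetic ψ) (hφ : ∀ g, {k | φ k = g}.Finite) (hc : φ.comp χ = ψ) :
    IsSyndetic χ := by
  obtain ⟨F, hF, h⟩ := hψ
  refine ⟨⋃ a ∈ F, {k | φ k = a}, hF.biUnion fun a _ => hφ a, fun g => ?_⟩
  obtain ⟨a, ha, n, hn⟩ := h (φ g)
  refine ⟨g * (χ n)⁻¹, Set.mem_biUnion ha ?_, n, by simp⟩
  rw [Set.mem_ofPred_eq, map_mul, map_inv, hn, ← hc]
  simp

theorem exists_hom_lift {φ : G' →* G} (hφ : Function.Surjective φ) (ψ : Multiplicative ℤ →* G) :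
    ∃ χ : Multiplicative ℤ →* G', φ.comp χ = ψ := by
  obtain ⟨g, hg⟩ := hφ (ψ (Multiplicative.ofAdd 1))
  refine ⟨zpowersHom G' g, MonoidHom.ext_mint ?_⟩
  simp [hg]

variable {Y : Type*} [MetricSpace Y] {ρ : G →* (Y ≃ₜ Y)}

/-- Closeness along `ψ n` passes to `a * ψ n` by uniform continuity of the finitely many coset
representatives `a`. -/
theorem isExpansive_comp [CompactSpace Y] (hρ : IsExpansive ρ) {ψ : Multiplicative ℤ →* G}
    (hψ : IsSyndetic ψ) : IsExpansive (ρ.comp ψ) := by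
  obtain ⟨Δ, h0, h1, hΔ⟩ := hρ
  obtain ⟨F, hF, h⟩ := hψ
  obtain ⟨κ, hκ, hmod⟩ := exists_modulus (fun g => (ρ g).continuous) hF h0
  refine ⟨min (κ / 2) Δ, lt_min (half_pos hκ) h0, (min_le_right _ _).trans h1, fun x y hxy => ?_⟩
  refine hΔ x y fun g => ?_
  obtain ⟨a, ha, n, rfl⟩ := h g
  rw [map_mul]
  exact (hmod a ha _ _ (((hxy n).trans (min_le_left _ _)).trans_lt (half_lt_self hκ))).le

theorem isHomoclinic_iff {o x : Y} :
    IsHomoclinic ρ o x ↔ Tendsto (fun g => ρ g x) cofinite (𝓝 o) := by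
  rw [Metric.tendsto_nhds]
  refine forall₂_congr fun ε _ => ⟨?_, fun h => ?_⟩
  · rintro ⟨E, hE, h⟩
    filter_upwards [hE.compl_mem_cofinite] with g hg using h g hg
  · exact ⟨_, h, fun g hg => not_not.1 hg⟩

theorem isHomoclinic_of_comp {ψ : Multiplicative ℤ →* G} (hψ : IsSyndetic ψ) {o x : Y}
    (ho : ∀ g, ρ g o = o) (hx : IsHomoclinic (ρ.comp ψ) o x) : IsHomoclinic ρ o x := by
  rw [isHomoclinic_iff] at hx
  obtain ⟨F, hF, h⟩ := hψ
  intro ε hε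
  refine ⟨⋃ a ∈ F, (fun n => a * ψ n) '' {n | ¬ dist (ρ a (ρ (ψ n) x)) o < ε},
    hF.biUnion fun a _ => Set.Finite.image _ ?_, fun g hg => ?_⟩
  · have h1 := ((ρ a).continuous.tendsto o).comp hx
    rw [ho] at h1
    exact (Metric.tendsto_nhds.1 h1) ε hε
  · by_contra hlt
    obtain ⟨a, ha, n, rfl⟩ := h g
    refine hg (Set.mem_biUnion ha ⟨n, ?_, rfl⟩)
    rwa [map_mul] at hlt

open scoped Pointwise in
/-- Copies of a homoclinic point can be placed at sparse positions, forming a designation. -/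
theorem exists_sparse_designation {o x : Y} (hx : IsHomoclinic ρ o x)
    {ψ : Multiplicative ℤ →* G} (hψ : Function.Injective ψ) {δ : ℝ} (hδ : 0 < δ) {E : Set G}
    (hE : E.Finite) {c : ℤ} (hc : c = 1 ∨ c = -1) :
    ∃ (A : ℕ → Set G) (a : ℕ → ℤ), IsIndexedPartition A ∧
      (∀ i, ψ (Multiplicative.ofAdd (a i)) ∈ A i) ∧ {i | (a i).sign = c}.Infinite ∧
      ∀ i, ∀ g ∈ border E (A i), dist (ρ (g * ψ (Multiplicative.ofAdd (-(a i)))) x) o < δ := by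
  obtain ⟨F₀, hF₀, hfar⟩ := hx δ hδ
  -- Each copy will occupy `F * h k`. Including `E * F₀` puts the border of this cell outside `F₀ *
  -- h k`, where the copy is already `δ`-small.
  set F : Set G := F₀ ∪ {1} ∪ E * F₀
  have hFfin : F.Finite := (hF₀.union (Set.finite_singleton 1)).union (hE.mul hF₀)
  have h1F : (1 : G) ∈ F := Or.inl (Or.inr rfl)
  -- If all positions and their differences avoid `B`, its three pieces keep, in order, the
  -- background's border outside `F₀`, the identity in the background, and the cells disjoint.
  set B : Set G := F⁻¹ * E * F₀ ∪ F⁻¹ ∪ F⁻¹ * F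
  have hBfin : B.Finite := (((hFfin.inv.mul hE).mul hF₀).union hFfin.inv).union
    (hFfin.inv.mul hFfin)
  have hBZ : {n : ℤ | ψ (Multiplicative.ofAdd n) ∈ B}.Finite :=
    hBfin.preimage ((hψ.comp Multiplicative.ofAdd.injective).injOn)
  obtain ⟨m, hm⟩ := (hBZ.image Int.natAbs).bddAbove
  have hbad : ∀ n : ℤ, m < n.natAbs → ψ (Multiplicative.ofAdd n) ∉ B := fun n hn hmem =>
    hn.not_ge (hm (Set.mem_image_of_mem _ hmem))
  have hcabs : c.natAbs = 1 := by rcases hc with rfl | rfl <;> rfl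
  let b : ℕ → ℤ := fun k => c * ((m + 1) * (k + 1) : ℕ)
  have hbabs : ∀ k, m < (b k).natAbs := by
    intro k
    simp only [b, Int.natAbs_mul, hcabs, Int.natAbs_natCast]
    nlinarith
  have hbdiff : ∀ k l, k ≠ l → m < (b k - b l).natAbs := by
    intro k l hkl
    have : b k - b l = c * ((m + 1 : ℕ) * ((k : ℤ) - l)) := by simp only [b]; push_cast; ring
    rw [this, Int.natAbs_mul, hcabs, Int.natAbs_mul, Int.natAbs_natCast]
    have h1 : 1 ≤ ((k : ℤ) - l).natAbs := by omega
    nlinarith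
  have hbsign : ∀ k, (b k).sign = c := by
    intro k
    have h1 : ((m + 1) * (k + 1) : ℕ) ≠ 0 := by positivity
    simp only [b]
    rw [Int.sign_mul, Int.sign_natCast_of_ne_zero h1, mul_one]
    rcases hc with rfl | rfl <;> rfl
  let h : ℕ → G := fun k => ψ (Multiplicative.ofAdd (b k))
  have hneg : ∀ n : ℤ, ψ (Multiplicative.ofAdd (-n)) = (ψ (Multiplicative.ofAdd n))⁻¹ :=
    fun n => by rw [ofAdd_neg, map_inv]
  -- Index `0` is the background, carrying a copy of `x` anchored at `0`; index `k + 1` is the cell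
  -- around `h k`.
  let A : ℕ → Set G := fun i => Nat.casesOn i {g | ∀ k, g * (h k)⁻¹ ∉ F}
    (fun k => {g | g * (h k)⁻¹ ∈ F})
  let a : ℕ → ℤ := fun i => Nat.casesOn i 0 b
  refine ⟨A, a, fun g => ?_, fun i => ?_, ?_, fun i g hg => ?_⟩
  · by_cases hg : ∃ k, g * (h k)⁻¹ ∈ F
    · obtain ⟨k, hk⟩ := hg
      refine ⟨k + 1, hk, fun j hj => ?_⟩
      cases j with
      | zero => exact absurd hk (hj k)
      | succ l =>
        by_contra hne
        have hlk : k ≠ l := by omega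
        refine hbad _ (hbdiff k l hlk) (Or.inr ?_)
        refine ⟨(g * (h k)⁻¹)⁻¹, Set.inv_mem_inv.2 hk, g * (h l)⁻¹, hj, ?_⟩
        simp [h, sub_eq_add_neg]
    · push Not at hg
      refine ⟨0, hg, fun j hj => ?_⟩
      cases j with
      | zero => rfl
      | succ l => exact absurd hj (hg l)
  · cases i with
    | zero =>
      intro k hk
      have e : ψ (Multiplicative.ofAdd (a 0)) = 1 := map_one ψ
      rw [e, one_mul] at hk
      exact hbad _ (hbabs k) (Or.inl (Or.inr (Set.mem_inv.2 hk)))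
    | succ k =>
      show ψ (Multiplicative.ofAdd (b k)) * (ψ (Multiplicative.ofAdd (b k)))⁻¹ ∈ F
      rw [mul_inv_cancel]
      exact h1F
  · refine Set.Infinite.mono (s := Set.range Nat.succ) ?_
      (Set.infinite_range_of_injective Nat.succ_injective)
    rintro _ ⟨k, rfl⟩
    exact hbsign k
  · obtain ⟨-, e, he, heg⟩ := hg
    cases i with
    | zero =>
      have ha0 : ψ (Multiplicative.ofAdd (-(a 0))) = 1 := map_one ψ
      rw [ha0, mul_one]
      refine hfar g fun hg0 => ?_
      have : ∃ k, e * g * (h k)⁻¹ ∈ F := by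
        by_contra! hno
        exact heg hno
      obtain ⟨k, hk⟩ := this
      refine hbad _ (hbabs k) (Or.inl (Or.inl ?_))
      refine ⟨(e * g * (h k)⁻¹)⁻¹ * e, ⟨_, Set.inv_mem_inv.2 hk, e, he, rfl⟩, g, hg0, ?_⟩
      simp only [h, mul_inv_rev, inv_inv]
      group
    | succ k =>
      show dist (ρ (g * ψ (Multiplicative.ofAdd (-(b k)))) x) o < δ
      rw [hneg]
      refine hfar _ fun hg0 => heg ?_
      show e * g * (h k)⁻¹ ∈ F
      rw [mul_assoc]
      exact Or.inr ⟨e, he, _, hg0, rfl⟩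

end Syndetic

/-! ### Tiered systems -/

namespace TieredSystem

variable {X : Type u} [MetricSpace X] [CompactSpace X]
  {T : Type v} [Preorder T] [IsDirectedOrder T] [OrderBot T]
  {G : T → Type w} [∀ t, Group (G t)]

open Classical in
/-- The action of `ℤ` on the tier `r` through `χ`, extended by the identity. -/
noncomputable def shift (𝒳 : TieredSystem X T G) (r : T) (χ : Multiplicative ℤ →* G r) (n : ℤ)
    (x : X) : X :=
  if h : x ∈ 𝒳.tier r then (𝒳.act r (χ (Multiplicative.ofAdd n)) ⟨x, h⟩ : X) else x

open Classical in
/-- A self-map of a tier, extended by the identity. -/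
noncomputable def extend (𝒳 : TieredSystem X T G) (t : T) (γ : 𝒳.tier t → 𝒳.tier t) (x : X) : X :=
  if h : x ∈ 𝒳.tier t then (γ ⟨x, h⟩ : X) else x

variable (𝒳 : TieredSystem X T G)

theorem extend_of_mem {t : T} (γ : 𝒳.tier t → 𝒳.tier t) {x : X} (h : x ∈ 𝒳.tier t) :
    𝒳.extend t γ x = γ ⟨x, h⟩ := dif_pos h

theorem continuousOn_extend {t : T} {γ : 𝒳.tier t → 𝒳.tier t} (hγ : Continuous γ) :
    ContinuousOn (𝒳.extend t γ) (𝒳.tier t) := by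
  rw [continuousOn_iff_continuous_domRestrict]
  refine (continuous_subtype_val.comp hγ).congr fun x => ?_
  simp [𝒳.extend_of_mem γ x.2]

theorem shift_of_mem {r a : T} (h : a ≤ r) (χ : Multiplicative ℤ →* G r) (n : ℤ) {x : X}
    (hx : x ∈ 𝒳.tier a) :
    𝒳.shift r χ n x = 𝒳.act a (𝒳.φ h (χ (Multiplicative.ofAdd n))) ⟨x, hx⟩ := by
  rw [shift, dif_pos (𝒳.tier_mono h hx), 𝒳.act_compat h ⟨x, hx⟩]

theorem shift_mem {r a : T} (h : a ≤ r) (χ : Multiplicative ℤ →* G r) (n : ℤ) {x : X}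
    (hx : x ∈ 𝒳.tier a) : 𝒳.shift r χ n x ∈ 𝒳.tier a := by
  rw [𝒳.shift_of_mem h χ n hx]
  exact Subtype.coe_prop _

theorem shift_zero {r : T} (χ : Multiplicative ℤ →* G r) (x : X) : 𝒳.shift r χ 0 x = x := by
  by_cases h : x ∈ 𝒳.tier r
  · simp [shift, h]
  · simp [shift, h]

theorem shift_add {r : T} (χ : Multiplicative ℤ →* G r) (m n : ℤ) (x : X) :
    𝒳.shift r χ (m + n) x = 𝒳.shift r χ m (𝒳.shift r χ n x) := by
  by_cases h : x ∈ 𝒳.tier r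
  · simp [shift, h, ofAdd_add]
  · simp [shift, h]

theorem map_shift {f : X → X} (hf : 𝒳.IsEvolution f) {r : T} (χ : Multiplicative ℤ →* G r)
    (n : ℤ) {x : X} (hx : x ∈ 𝒳.tier r) (hfx : f x ∈ 𝒳.tier r) :
    f (𝒳.shift r χ n x) = 𝒳.shift r χ n (f x) := by
  have := hf.map_act (le_refl r) ⟨x, hx⟩ hfx (χ (Multiplicative.ofAdd n))
  rw [𝒳.φ_refl] at this
  simpa [shift, hx, hfx] using this

theorem iterate_shift {f : X → X} (hf : 𝒳.IsEvolution f) {r : T} (χ : Multiplicative ℤ →* G r)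
    (k : ℕ) (n : ℤ) {x : X} (hx : ∀ k, f^[k] x ∈ 𝒳.tier r) :
    f^[k] (𝒳.shift r χ n x) = 𝒳.shift r χ n (f^[k] x) := by
  induction k with
  | zero => rfl
  | succ k ih =>
    have := hx (k + 1)
    rw [Function.iterate_succ_apply'] at this
    rw [Function.iterate_succ_apply', ih, 𝒳.map_shift hf χ n (hx k) this,
      Function.iterate_succ_apply']

/-- Working in a tier `r` that contains all trajectories starting in `w'` makes expansiveness
available for the images as well. -/
theorem exists_isPartialZSystem {f : X → X} (hf : 𝒳.IsEvolution f) {w' r : T}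
    (hw : 𝒳.StabilizesAt f w' r) (hasymp : AsympNilpotentOn f 𝒳.zero (𝒳.tier w'))
    {χ : Multiplicative ℤ →* G r} (hχ : IsSyndetic χ) :
    ∃ Δ, IsPartialZSystem (𝒳.shift r χ) 𝒳.zero f (𝒳.tier w') (𝒳.tier r) Δ := by
  have : CompactSpace (𝒳.tier r) := isCompact_iff_compactSpace.1 (𝒳.isClosed_tier r).isCompact
  obtain ⟨Δ, h0, -, hΔ⟩ := isExpansive_comp (𝒳.expansive r) hχ
  refine ⟨Δ, 𝒳.shift_zero χ, 𝒳.shift_add χ, fun n => ?_, 𝒳.isClosed_tier w', 𝒳.zero_mem w',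
    fun n x hx => 𝒳.shift_mem hw.1 χ n hx, fun n => ?_, hf.continuous, hw.2,
    fun n x hx => 𝒳.shift_mem le_rfl χ n hx,
    fun k n x hx => 𝒳.iterate_shift hf χ k n fun k => hw.2 k x hx, hasymp, h0,
    fun x hx y hy hxy => ?_⟩
  · rw [𝒳.shift_of_mem le_rfl χ n (𝒳.zero_mem r), 𝒳.act_zero]
  · exact (𝒳.continuousOn_extend (𝒳.act r _).continuous).mono (𝒳.tier_mono hw.1)
  · have := hΔ ⟨x, hx⟩ ⟨y, hy⟩ fun n => by
      have := hxy n.toAdd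
      simpa [shift, hx, hy, Subtype.dist_eq] using this
    exact congrArg Subtype.val this

/-- The closure of the union of the forward images of a tier. -/
def orbitClosure (f : X → X) (t : T) : Set X := closure (⋃ k : ℕ, f^[k] '' 𝒳.tier t)

theorem tier_subset_orbitClosure (f : X → X) (t : T) : 𝒳.tier t ⊆ 𝒳.orbitClosure f t :=
  fun x hx => subset_closure (Set.mem_iUnion.2 ⟨0, x, hx, rfl⟩)

theorem orbitClosure_subset {f : X → X} {t s : T} (h : 𝒳.StabilizesAt f t s) :
    𝒳.orbitClosure f t ⊆ 𝒳.tier s := by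
  refine closure_minimal (Set.iUnion_subset fun k => ?_) (𝒳.isClosed_tier s)
  rintro _ ⟨x, hx, rfl⟩
  exact h.2 k x hx

theorem mapsTo_orbitClosure {f : X → X} (hf : Continuous f) (t : T) :
    Set.MapsTo f (𝒳.orbitClosure f t) (𝒳.orbitClosure f t) := by
  refine Set.MapsTo.closure ?_ hf
  rintro y hy
  obtain ⟨k, x, hx, rfl⟩ := Set.mem_iUnion.1 hy
  exact Set.mem_iUnion.2 ⟨k + 1, x, hx, Function.iterate_succ_apply' f k x⟩

theorem shift_mapsTo_orbitClosure {f : X → X} (hf : 𝒳.IsEvolution f) {t s r : T}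
    (h : 𝒳.StabilizesAt f t s) (hsr : s ≤ r) (χ : Multiplicative ℤ →* G r) (n : ℤ) :
    Set.MapsTo (𝒳.shift r χ n) (𝒳.orbitClosure f t) (𝒳.orbitClosure f t) := by
  have hsub : 𝒳.orbitClosure f t ⊆ 𝒳.tier r := (𝒳.orbitClosure_subset h).trans (𝒳.tier_mono hsr)
  refine Set.MapsTo.closure_of_continuousOn ?_
    ((𝒳.continuousOn_extend (𝒳.act r _).continuous).mono hsub)
  rintro y hy
  obtain ⟨k, x, hx, rfl⟩ := Set.mem_iUnion.1 hy
  refine Set.mem_iUnion.2 ⟨k, 𝒳.shift r χ n x, 𝒳.shift_mem (h.1.trans hsr) χ n hx, ?_⟩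
  exact 𝒳.iterate_shift hf χ k n fun k => 𝒳.tier_mono hsr (h.2 k x hx)

/-- The map need not preserve the tier `t`, so the single-system result is applied to its orbit
closure, which is invariant and still inside the tier `s`. -/
theorem exists_spaceship {f : X → X} (hf : 𝒳.IsEvolution f) {t s w' r : T}
    (hts : 𝒳.StabilizesAt f t s) (hsw : s ≤ w') (hwr : w' ≤ r) {χ : Multiplicative ℤ →* G r}
    {Δ : ℝ} (hP : IsPartialZSystem (𝒳.shift r χ) 𝒳.zero f (𝒳.tier w') (𝒳.tier r) Δ)
    (hnil : ¬ NilpotentOn f 𝒳.zero (𝒳.tier t)) :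
    ∃ p q, ∃ z ∈ 𝒳.orbitClosure f t,
      IsZEndomorphism.IsSpaceship (𝒳.shift r χ) 𝒳.zero f p q z := by
  set C := 𝒳.orbitClosure f t
  have hCs : C ⊆ 𝒳.tier s := 𝒳.orbitClosure_subset hts
  have hCw : C ⊆ 𝒳.tier w' := hCs.trans (𝒳.tier_mono hsw)
  have hCf : Set.MapsTo f C C := 𝒳.mapsTo_orbitClosure hf.continuous t
  have hCσ : ∀ n, Set.MapsTo (𝒳.shift r χ n) C C :=
    𝒳.shift_mapsTo_orbitClosure hf hts (hsw.trans hwr) χ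
  have : CompactSpace C := isCompact_iff_compactSpace.1 isClosed_closure.isCompact
  have h0 : 𝒳.zero ∈ C := 𝒳.tier_subset_orbitClosure f t (𝒳.zero_mem t)
  have hiter : ∀ (k : ℕ) (x : C), ((hCf.restrict f C C)^[k] x : X) = f^[k] x := fun k x => by
    rw [hCf.iterate_restrict]; rfl
  have hZ : IsZEndomorphism (fun n => (hCσ n).restrict (𝒳.shift r χ n) C C) ⟨𝒳.zero, h0⟩
      (hCf.restrict f C C) Δ :=
    { continuous_shift := fun n => ((hP.continuousOn_shift n).mono hCw).mapsToRestrict (hCσ n)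
      shift_zero := fun x => Subtype.ext (hP.shift_zero x)
      shift_add := fun m n x => Subtype.ext (hP.shift_add m n x)
      shift_base := fun n => Subtype.ext (hP.shift_base n)
      continuous := hf.continuous.continuousOn.mapsToRestrict hCf
      map_base := Subtype.ext hP.map_base
      comm := fun n x => Subtype.ext (hP.iterate_comm 1 n x (hCw x.2))
      pos := hP.pos
      expansive := fun x y hxy => Subtype.ext
        (hP.expansive x (hP.mem_ambient (hCw x.2)) y (hP.mem_ambient (hCw y.2)) hxy) }
  obtain ⟨p, q, z, hz0, hp, hpq, hhom⟩ := hZ.exists_spaceship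
    (fun x => by
      rw [tendsto_subtype_rng]
      refine (hP.asymp x (hCw x.2)).congr fun k => (hiter k x).symm)
    (by
      rintro ⟨n, hn⟩
      refine hnil ⟨n, fun x hx => ?_⟩
      rw [← hiter n ⟨x, 𝒳.tier_subset_orbitClosure f t hx⟩, hn])
  refine ⟨p, q, z, z.2, fun ho => hz0 (Subtype.ext ho), hp, ?_, ?_⟩
  · rw [← hiter, hpq]; rfl
  · exact (continuous_subtype_val.tendsto _).comp hhom

theorem nilpotentOn_of_recurrence {f : X → X} (hf : 𝒳.IsEvolution f) {t s w' : T}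
    (hts : 𝒳.StabilizesAt f t s) (hsw : s ≤ w') {ψ : Multiplicative ℤ →* G w'}
    (hψ : IsSyndetic ψ) (hrec : 𝒳.HomoclinicRecurrenceVia f hsw ψ) (hw : 𝒳.IsStabilizing f w')
    (hasymp : AsympNilpotentOn f 𝒳.zero (𝒳.tier w')) :
    NilpotentOn f 𝒳.zero (𝒳.tier t) := by
  obtain ⟨r, hwr⟩ := hw
  -- Recurrence is given for `ψ` at `w'`, while expansiveness is needed at `r`. As `ℤ` is free, `ψ`
  -- lifts, and finite fibres keep the lift syndetic.
  obtain ⟨χ, hχ⟩ := exists_hom_lift (𝒳.φ_surjective hwr.1) ψ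
  obtain ⟨Δ, hP⟩ := 𝒳.exists_isPartialZSystem hf hwr hasymp
    (hψ.of_comp (𝒳.φ_finite_to_one hwr.1) hχ)
  by_contra hnil
  obtain ⟨p, q, z, hzC, hz⟩ := 𝒳.exists_spaceship hf hts hsw hwr.1 hP hnil
  have hzs : z ∈ 𝒳.tier s := 𝒳.orbitClosure_subset hts hzC
  have hCw : 𝒳.orbitClosure f t ⊆ 𝒳.tier w' :=
    (𝒳.orbitClosure_subset hts).trans (𝒳.tier_mono hsw)
  have hσw : ∀ (n : ℤ) (x : 𝒳.tier w'), 𝒳.shift r χ n x =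
      𝒳.act w' (ψ (Multiplicative.ofAdd n)) x := fun n x => by
    rw [𝒳.shift_of_mem hwr.1 χ n x.2, ← hχ]; rfl
  have hσs : ∀ (n : ℤ) (x : 𝒳.tier s), 𝒳.shift r χ n x =
      𝒳.act s (𝒳.φ hsw (ψ (Multiplicative.ofAdd n))) x := fun n x => by
    rw [𝒳.act_compat hsw x]
    exact hσw n ⟨x, 𝒳.tier_mono hsw x.2⟩
  obtain ⟨Γ, hΓfin, hΓsym, hΓ⟩ := hrec
  have hS : IsSymmetrySet (𝒳.shift r χ) 𝒳.zero f (𝒳.tier w') z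
      ((fun γ : 𝒳.tier w' ≃ₜ 𝒳.tier w' => 𝒳.extend w' γ) '' Γ) := by
    refine ⟨hΓfin.image _, ?_, ?_, ?_, ?_⟩
    · rintro _ ⟨γ, hγ, rfl⟩
      simp only
      rw [𝒳.extend_of_mem γ (𝒳.zero_mem w')]
      exact congrArg Subtype.val (hΓsym hγ).2.2
    · rintro _ ⟨γ, hγ, rfl⟩
      exact 𝒳.continuousOn_extend γ.continuous _ (𝒳.zero_mem w')
    · rintro _ ⟨γ, hγ, rfl⟩ u hu h
      simp only at h
      rw [𝒳.extend_of_mem γ hu] at h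
      have := γ.injective ((Subtype.ext h : γ ⟨u, hu⟩ = 𝒳.zeroAt w').trans (hΓsym hγ).2.2.symm)
      exact congrArg Subtype.val this
    -- Symmetries commute with `f` only where source and image lie in `w'`; the whole orbit of `z`
    -- does, since it stays in the orbit closure.
    · rintro _ ⟨γ, hγ, rfl⟩ k n
      have hu := 𝒳.shift_mapsTo_orbitClosure hf hts (hsw.trans hwr.1) χ n hzC
      induction k with
      | zero => rfl
      | succ k ih =>
        have hk := (𝒳.mapsTo_orbitClosure hf.continuous t).iterate k hu
        have hk' := 𝒳.mapsTo_orbitClosure hf.continuous t hk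
        rw [Function.iterate_succ_apply', ih, Function.iterate_succ_apply']
        simp only
        rw [𝒳.extend_of_mem γ (hCw hk), 𝒳.extend_of_mem γ (hCw hk'),
          ← (hΓsym hγ).1 ⟨_, hCw hk⟩ (hCw hk')]
  refine hP.not_recurrent hz (hCw hzC) hS fun ε hε c hc => ?_
  have hhom : IsHomoclinic ((𝒳.act s).comp ((𝒳.φ hsw).comp ψ)) (𝒳.zeroAt s) ⟨z, hzs⟩ := by
    rw [isHomoclinic_iff, tendsto_subtype_rng]
    refine (hz.2.2.2.comp Multiplicative.toAdd.injective.tendsto_cofinite).congr fun n => ?_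
    exact hσs n.toAdd ⟨z, hzs⟩
  obtain ⟨I, A, a, hpart, hanch, hinf, y, γ, hγ, hd⟩ := hΓ ⟨z, hzs⟩ hhom ε hε c hc
  choose i hi huniq using fun n : ℤ => hpart (Multiplicative.ofAdd n)
  have hia : ∀ j, i (a j) = j := fun j => (huniq (a j) j (hanch j)).symm
  -- At time `n` the anchor and symmetry are those of the cell containing `n`; an anchor lies in its
  -- own cell, which gives idempotence.
  refine ⟨y, y.2, fun n => a (i n), fun n => 𝒳.extend w' (γ (i n)),
    ⟨fun n => ⟨_, hγ _, rfl⟩, fun n => by rw [hia], fun n => by rw [hia], fun n => ?_⟩, ?_⟩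
  · have := hd (i n) (Multiplicative.ofAdd n) (hi n)
    have hzn : 𝒳.shift r χ (n - a (i n)) z ∈ 𝒳.tier w' :=
      𝒳.shift_mem hwr.1 χ _ (𝒳.tier_mono hsw hzs)
    have e : (⟨_, hzn⟩ : 𝒳.tier w') = 𝒳.act w' (ψ (Multiplicative.ofAdd n)) (𝒳.incl hsw
        (𝒳.act s (𝒳.φ hsw (ψ (Multiplicative.ofAdd (-(a (i n)))))) ⟨z, hzs⟩)) := by
      refine Subtype.ext ?_
      rw [← hσw]
      show _ = 𝒳.shift r χ n (𝒳.act s (𝒳.φ hsw (ψ (Multiplicative.ofAdd (-(a (i n)))))) ⟨z, hzs⟩)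
      rw [← hσs, ← 𝒳.shift_add, ← sub_eq_add_neg]
    rw [hσw, 𝒳.extend_of_mem _ hzn, e]
    exact this
  · refine (hinf.image (f := a) fun j _ k _ hjk => ?_).mono ?_
    · rw [← hia j, ← hia k, hjk]
    · rintro _ ⟨j, hj, rfl⟩
      exact ⟨congrArg a (hia j), hj⟩

/-- Gluing the sparse copies in `G w'` gives a realization whose restriction along `ψ` is the
required recurrent one. -/
theorem exists_homoclinicRecurrenceVia {f : X → X} {t : T} (hglue : 𝒳.IsWeaklyVariablyGluing f t)
    (hψ : ∀ w' : T, ∃ ψ : Multiplicative ℤ →* G w', IsSyndetic ψ ∧ Function.Injective ψ) :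
    ∃ (w' : T) (h : t ≤ w') (ψ : Multiplicative ℤ →* G w'), IsSyndetic ψ ∧
      𝒳.HomoclinicRecurrenceVia f h ψ := by
  obtain ⟨w', h, Γ, hΓ, hΓs, hglue⟩ := hglue
  obtain ⟨ψ, hψ, hinj⟩ := hψ w'
  refine ⟨w', h, ψ, hψ, Γ, hΓ, hΓs, fun x hx ε hε c hc => ?_⟩
  have hincl : ∀ (g : G w') (y : 𝒳.tier t), 𝒳.incl h (𝒳.act t (𝒳.φ h g) y) =
      𝒳.act w' g (𝒳.incl h y) := fun g y => Subtype.ext (𝒳.act_compat h y g)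
  have hx' : IsHomoclinic (𝒳.act w') (𝒳.zeroAt w') (𝒳.incl h x) := by
    refine isHomoclinic_of_comp hψ (𝒳.act_zero w') fun ε hε => ?_
    obtain ⟨E, hE, hE'⟩ := hx ε hε
    refine ⟨E, hE, fun g hg => ?_⟩
    have := hE' g hg
    rw [MonoidHom.comp_apply, ← hincl]
    exact this
  obtain ⟨δ, E, hδ, hE, hreal⟩ := hglue ε hε
  obtain ⟨A, a, hpart, hanch, hinf, hbd⟩ := exists_sparse_designation hx' hinj hδ hE hc
  -- The gluing property quantifies over index types in universe `w`, hence the lift of `ℕ`.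
  obtain ⟨y, γ, hγ, hy⟩ := hreal (ULift ℕ) (fun i => A i.down)
    (fun i => 𝒳.act t (𝒳.φ h (ψ (Multiplicative.ofAdd (-(a i.down))))) x)
    ⟨fun g => by
      obtain ⟨i, hi, huniq⟩ := hpart g
      exact ⟨⟨i⟩, hi, fun j hj => ULift.ext _ _ (huniq _ hj)⟩,
    fun i g hg => by
      have := hbd i.down g hg
      rw [map_mul] at this
      show dist (𝒳.act w' g (𝒳.incl h _)) _ < δ
      rw [hincl]
      exact this⟩
  exact ⟨ℕ, fun i => ψ ⁻¹' A i, a, fun n => hpart (ψ n), hanch, hinf, y, fun i => γ ⟨i⟩,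
    fun i => hγ _, fun i n hn => hy ⟨i⟩ (ψ n) hn⟩

theorem exists_syndetic_hom (𝒳 : TieredSystem X T G) {G₀ : Type*} [Group G₀] (e : G ⊥ ≃* G₀) (hG : VirtuallyZ G₀) (t : T) :
    ∃ ψ : Multiplicative ℤ →* G t, IsSyndetic ψ ∧ Function.Injective ψ := by
  obtain ⟨H, hH, ⟨i⟩⟩ := hG
  have h0 : IsSyndetic (e.symm.toMonoidHom.comp (H.subtype.comp i.toMonoidHom)) := by
    refine (isSyndetic_of_finiteIndex i).of_comp (φ := e.toMonoidHom) (fun g => ?_) ?_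
    · exact (Set.finite_singleton g).preimage e.injective.injOn
    · ext; simp
  obtain ⟨ψ, hψ⟩ := exists_hom_lift (𝒳.φ_surjective (bot_le : ⊥ ≤ t))
    (e.symm.toMonoidHom.comp (H.subtype.comp i.toMonoidHom))
  refine ⟨ψ, h0.of_comp (𝒳.φ_finite_to_one bot_le) hψ, ?_⟩
  have hinj : Function.Injective ((𝒳.φ (bot_le : ⊥ ≤ t)).comp ψ) := by
    rw [hψ]
    exact e.symm.injective.comp (H.subtype_injective.comp i.injective)
  exact Function.Injective.of_comp hinj

end TieredSystem

end NilRigid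

theorem mainTheorem4 :
    -- every virtually-`ℤ` group is nil-rigid on the class `𝔠₁`
    (∀ (G₀ : Type w) [Group G₀], VirtuallyZ G₀ → GroupNilRigidOn classC1.{u, v, w} G₀) ∧
    -- tiered systems all of whose groups are `ℤ`
    (∀ (X : Type u) [MetricSpace X] [CompactSpace X]
      (T : Type v) [Preorder T] [IsDirectedOrder T] [OrderBot T]
      (𝒳 : TieredSystem X T (fun _ => Multiplicative ℤ))
      (_ : ∀ {t t' : T} (h : t ≤ t'), 𝒳.φ h = MonoidHom.id (Multiplicative ℤ))
      (f : X → X) (_ : 𝒳.IsEvolution f)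
      (t s w' : T) (_ : 𝒳.StabilizesAt f t s) (hsw : s ≤ w')
      (_ : 𝒳.HomoclinicRecurrenceVia f hsw (MonoidHom.id (Multiplicative ℤ)))
      (_ : 𝒳.IsStabilizing f w')
      (_ : AsympNilpotentOn f 𝒳.zero (𝒳.tier w')),
      NilpotentOn f 𝒳.zero (𝒳.tier t)) ∧
    -- tiered systems whose base group is virtually `ℤ`
    (∀ (X : Type u) [MetricSpace X] [CompactSpace X]
      (T : Type v) [Preorder T] [IsDirectedOrder T] [OrderBot T]
      (G : T → Type w) [∀ t, Group (G t)]
      (𝒳 : TieredSystem X T G) (_ : VirtuallyZ (G ⊥))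
      (f : X → X) (_ : 𝒳.IsEvolution f)
      (t s w' : T) (_ : 𝒳.StabilizesAt f t s) (hsw : s ≤ w')
      (_ : 𝒳.HomoclinicRecurrence f hsw)
      (_ : 𝒳.IsStabilizing f w')
      (_ : AsympNilpotentOn f 𝒳.zero (𝒳.tier w')),
      NilpotentOn f 𝒳.zero (𝒳.tier t)) ∧
    -- expansive pointed `ℤ`-systems
    (∀ (X : Type u) [MetricSpace X] [CompactSpace X]
      (ρ : Multiplicative ℤ →* (X ≃ₜ X)) (o : X) (_ : ∀ n, ρ n o = o) (_ : IsExpansive ρ)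
      (_ : ∀ x : X, IsHomoclinic ρ o x → ∀ ε : ℝ, 0 < ε → ∃ x₁ x₂ : X,
        (∀ n : ℤ, ∃ k : ℤ,
          dist (ρ (Multiplicative.ofAdd n) x₁) (ρ (Multiplicative.ofAdd k) x) < ε) ∧
        (∀ n : ℤ, ∃ k : ℤ,
          dist (ρ (Multiplicative.ofAdd n) x₂) (ρ (Multiplicative.ofAdd k) x) < ε) ∧
        {n : ℤ | 0 < n ∧ dist (ρ (Multiplicative.ofAdd n) x₁) x < ε}.Infinite ∧
        {n : ℤ | n < 0 ∧ dist (ρ (Multiplicative.ofAdd n) x₂) x < ε}.Infinite)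
      (f : X → X) (_ : IsEndomorphism ρ o f)
      (_ : AsympNilpotentOn f o Set.univ),
      NilpotentOn f o Set.univ) := by
  refine ⟨?_, ?_, ?_, ?_⟩
  · rintro G₀ _ hG X _ _ T _ _ _ G _ 𝒳 ⟨e⟩ f hf ⟨hstab, hglue⟩ hasymp t
    obtain ⟨s, hts⟩ := hstab t
    obtain ⟨w', hsw, ψ, hψ, hrec⟩ := 𝒳.exists_homoclinicRecurrenceVia (hglue s)
      (𝒳.exists_syndetic_hom e hG)
    exact 𝒳.nilpotentOn_of_recurrence hf hts hsw hψ hrec (hstab w')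
      fun x _ => hasymp x (Set.mem_univ x)
  · intro X _ _ T _ _ _ 𝒳 _ f hf t s w' hts hsw hrec hw hasymp
    exact 𝒳.nilpotentOn_of_recurrence hf hts hsw
      ⟨{1}, Set.finite_singleton 1, fun g => ⟨1, rfl, g, by simp⟩⟩ hrec hw hasymp
  · rintro X _ _ T _ _ _ G _ 𝒳 - f hf t s w' hts hsw ⟨H, hH, e, hrec⟩ hw hasymp
    exact 𝒳.nilpotentOn_of_recurrence hf hts hsw (isSyndetic_of_finiteIndex e) hrec hw hasymp
  · rintro X _ _ ρ o ho ⟨Δ, h0, -, hΔ⟩ hrep f hf hasymp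
    have hZ : IsZEndomorphism (fun n : ℤ => ρ (Multiplicative.ofAdd n)) o f Δ :=
      ⟨fun n => (ρ _).continuous, fun x => by simp, fun m n x => by simp [ofAdd_add],
        fun n => ho _, hf.continuous, hf.map_zero, fun n x => hf.map_act _ x, h0,
        fun x y hxy => hΔ x y fun g => hxy g.toAdd⟩
    have hP : IsPartialZSystem (fun n : ℤ => ρ (Multiplicative.ofAdd n)) o f Set.univ Set.univ Δ :=
      ⟨hZ.shift_zero, hZ.shift_add, hZ.shift_base, isClosed_univ, Set.mem_univ o,
        fun _ _ _ => Set.mem_univ _, fun n => (hZ.continuous_shift n).continuousOn, hf.continuous,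
        fun _ _ _ => Set.mem_univ _, fun _ _ _ => Set.mem_univ _,
        fun k n x _ => hZ.iterate_comm k n x, hasymp, h0, fun x _ y _ hxy => hZ.expansive x y hxy⟩
    by_contra hnil
    obtain ⟨p, q, z, hz⟩ := hZ.exists_spaceship (fun x => hasymp x (Set.mem_univ x))
      (fun ⟨n, hn⟩ => hnil ⟨n, fun x _ => hn x⟩)
    refine hP.not_repeated hz fun ε hε c hc => ?_
    have hhom : IsHomoclinic ρ o z := isHomoclinic_iff.2
      (hz.2.2.2.comp Multiplicative.toAdd.injective.tendsto_cofinite)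
    obtain ⟨x₁, x₂, h₁, h₂, h₁', h₂'⟩ := hrep z hhom ε hε
    rcases hc with rfl | rfl
    · exact ⟨x₁, h₁, by simpa only [Int.sign_eq_one_iff_pos] using h₁'⟩
    · exact ⟨x₂, h₂, by simpa only [Int.sign_eq_neg_one_iff_neg] using h₂'⟩
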